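/- Let $\mathbb O$ be the octonions with their inner product $x\cdot y$, norm $|x|$, conjugation $C(x)=\bar x=2(x\cdot 1)1-x$, and left and right multiplications $L_u(x)=ux$, $R_u(x)=xu$. Let $\mathfrak{spin}(8)$ be the Lie algebra, consisting of triples $a=(a_1,a_2,a_3)$, of the group of triples $(g_1,g_2,g_3)\in SO(\mathbb O)^3$ with $g_2(xy)=g_1(x)g_3(y)$ for all $x,y\in\mathbb O$. Write elements of $\mathbb O^4$ as columns $\mathbf z=(x_1,y_1,x_2,y_2)$. For $x,y,z\in\mathbb R$, $u,v,w\in\mathbb O$, $a\in\mathfrak{spin}(8)$ put $$A=\begin{pmatrix} a_1+x&CR_u&y&CR_v\\ -CL_u&a_3+x&CL_v&-y\\ z&CR_w&a_1-x&CR_u\\ CL_w&-z&-CL_u&a_3-x\end{pmatrix}\in\operatorname{End}_{\mathbb R}(\mathbb O^4);$$ these $A$ form $\mathfrak{spin}(10,1)$, and those with $x=0$, $z=-y$, $w=-v$ form $\mathfrak{spin}(10)$. Let $\mathrm{Spin}(10)$ be the connected subgroup with Lie algebra $\mathfrak{spin}(10)$ (the group generated by $\exp\mathfrak{spin}(10)$),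 and let $\mathrm{Spin}(10,1)$ be the subgroup of $GL_{\mathbb R}(\mathbb O^4)$ (in fact of $SL_{\mathbb R}(\mathbb O^4)$) generated by $\mathrm{Spin}(10)$ and the maps $\operatorname{diag}(t,t,t^{-1},t^{-1})$, $t>0$. On $\mathbb R^{2+1}\oplus\mathbb O$ put $(a_1,a_2,a_3,\mathbf x)\cdot(b_1,b_2,b_3,\mathbf y)=-2(a_1b_3+a_3b_1)+a_2b_2+\mathbf x\cdot\mathbf y$. Let $SO(10,1)$ be the group of linear maps of determinant one preserving this form, and $SO^\uparrow(10,1)$ its identity component. A vector $b$ is called future-directed if $b\cdot(1,0,1,0)<0$; the forward light cone consists of the future-directed $b$ with $b\cdot b=0$, and $b$ is timelike if $b\cdot b<0$. With $q^*(\cdot)=\langle q,\cdot\rangle$, put $$\rho'(A)=\begin{pmatrix}2x&y&0&\bar v^*\\ 2z&0&2y&2\bar u^*\\ 0&z&-2x&\bar w^*\\ 2\bar w&-2\bar u&2\bar v&a_2\end{pmatrix}.$$ Finally, let $$\sigma(\mathbf z)=\bigl(|x_1|^2+|y_1|^2,\;2(x_1\cdot x_2-y_1\cdot y_2),\;|x_2|^2+|y_2|^2,\;2(x_1y_2+x_2y_1)\bigr),$$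 $$p(\mathbf z)=|x_1|^2|x_2|^2+|y_1|^2|y_2|^2-(x_1\cdot x_2+y_1\cdot y_2)^2+2(x_1y_1)\cdot(x_2y_2).$$ Then $\exp A\in\mathrm{Spin}(10,1)$ for all $A\in\mathfrak{spin}(10,1)$, and there is exactly one continuous homomorphism $\rho:\mathrm{Spin}(10,1)\to SO^\uparrow(10,1)$ that induces $\rho'$ on Lie algebras, i.e. with $\rho(\exp A)=\exp\rho'(A)$ for all $A\in\mathfrak{spin}(10,1)$. Moreover: 1. $\rho$ is a double cover (a covering map all of whose fibres have exactly two points); 2. $\sigma(g\mathbf z)=\rho(g)\,\sigma(\mathbf z)$ for all $g\in\mathrm{Spin}(10,1)$, $\mathbf z\in\mathbb O^4$; 3. $p(\mathbf z)=-\tfrac14\,\sigma(\mathbf z)\cdot\sigma(\mathbf z)$ for all $\mathbf z$, and $p(g\mathbf z)=p(\mathbf z)$ for all $g\in\mathrm{Spin}(10,1)$; 4. $\sigma$ maps the $\mathrm{Spin}(10,1)$-orbit of each $\mathbf z$ onto the $SO^\uparrow(10,1)$-orbit of $\sigma(\mathbf z)$; 5. the image of $\sigma$ is the union of the origin, the forward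 light cone and the set of future-directed timelike vectors. -/

import Mathlib

open scoped Quaternion RealInnerProductSpace

noncomputable section

namespace Bryant

/-! ### The octonions -/

/-- The octonions, as pairs of quaternions, with the Euclidean inner product of `ℝ⁸`. -/
def Octonion : Type := WithLp 2 (ℍ[ℝ] × ℍ[ℝ])

instance : NormedAddCommGroup Octonion :=
  inferInstanceAs (NormedAddCommGroup (WithLp 2 (ℍ[ℝ] × ℍ[ℝ])))

instance : InnerProductSpace ℝ Octonion :=
  inferInstanceAs (InnerProductSpace ℝ (WithLp 2 (ℍ[ℝ] × ℍ[ℝ])))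

instance : NormedSpace ℝ Octonion := InnerProductSpace.toNormedSpace

instance : FiniteDimensional ℝ Octonion :=
  inferInstanceAs (FiniteDimensional ℝ (WithLp 2 (ℍ[ℝ] × ℍ[ℝ])))

/-- The octonion `(a, b)`. -/
def Octonion.mk (a b : ℍ[ℝ]) : Octonion := WithLp.toLp 2 (a, b)

/-- First quaternionic component. -/
def Octonion.fst (x : Octonion) : ℍ[ℝ] := WithLp.fst x

/-- Second quaternionic component. -/
def Octonion.snd (x : Octonion) : ℍ[ℝ] := WithLp.snd x

/-- Cayley–Dickson multiplication `(a, b) (c, d) = (a c - d̄ b, d a + b c̄)`. -/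
instance : Mul Octonion where
  mul x y := Octonion.mk
    (x.fst * y.fst - star y.snd * x.snd) (y.snd * x.fst + x.snd * star y.fst)

theorem Octonion.ext' {x y : Octonion} (h : x.fst = y.fst) (h' : x.snd = y.snd) : x = y :=
  WithLp.ofLp_injective 2 (Prod.ext h h')

theorem Octonion.fst_mul (x y : Octonion) :
    (x * y).fst = x.fst * y.fst - star y.snd * x.snd := rfl

theorem Octonion.snd_mul (x y : Octonion) :
    (x * y).snd = y.snd * x.fst + x.snd * star y.fst := rfl

theorem Octonion.fst_add (x y : Octonion) : (x + y).fst = x.fst + y.fst := rfl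

theorem Octonion.snd_add (x y : Octonion) : (x + y).snd = x.snd + y.snd := rfl

theorem Octonion.fst_smul (t : ℝ) (x : Octonion) : (t • x).fst = t • x.fst := rfl

theorem Octonion.snd_smul (t : ℝ) (x : Octonion) : (t • x).snd = t • x.snd := rfl


instance : One Octonion where
  one := Octonion.mk 1 0

/-- Real-linear endomorphisms of the octonions. -/
abbrev EndO : Type := Octonion →L[ℝ] Octonion

/-- Left multiplication `L_u : x ↦ u x`. -/
def L (u : Octonion) : EndO :=
  LinearMap.toContinuousLinearMap
    { toFun := fun x => u * x
      map_add' := fun x y => by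
        apply Octonion.ext' <;>
          simp only [Octonion.fst_mul, Octonion.snd_mul, Octonion.fst_add, Octonion.snd_add,
            star_add] <;> noncomm_ring
      map_smul' := fun t x => by
        apply Octonion.ext' <;>
          simp [Octonion.fst_mul, Octonion.snd_mul, Octonion.fst_smul, Octonion.snd_smul,
            smul_sub] }

/-- Right multiplication `R_u : x ↦ x u`. -/
def R (u : Octonion) : EndO :=
  LinearMap.toContinuousLinearMap
    { toFun := fun x => x * u
      map_add' := fun x y => by
        apply Octonion.ext' <;>
          simp only [Octonion.fst_mul, Octonion.snd_mul, Octonion.fst_add, Octonion.snd_add] <;>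
          noncomm_ring
      map_smul' := fun t x => by
        apply Octonion.ext' <;>
          simp [Octonion.fst_mul, Octonion.snd_mul, Octonion.fst_smul, Octonion.snd_smul,
            smul_sub] }

/-- Octonionic conjugation `C : x ↦ x̄ = 2 ⟨x, 1⟩ 1 - x`. -/
def C : EndO := (2 : ℝ) • (innerSL ℝ (1 : Octonion)).smulRight (1 : Octonion) - 1

/-! ### `Spin(8)` through triality, and its Lie algebra -/

/-- Membership in `SO(𝕆) = SO(8)`. -/
def IsSO (g : EndO) : Prop :=
  (∀ x, ‖g x‖ = ‖x‖) ∧ LinearMap.det (g : Octonion →ₗ[ℝ] Octonion) = 1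

/-- The group `H ≅ Spin(8)` of triples `(g₁, g₂, g₃) ∈ SO(8)³` with `g₂ (x y) = g₁ x · g₃ y`. -/
def H : Set (EndO × EndO × EndO) :=
  {g | IsSO g.1 ∧ IsSO g.2.1 ∧ IsSO g.2.2 ∧ ∀ x y : Octonion, g.2.1 (x * y) = g.1 x * g.2.2 y}

/-- The Lie algebra `𝔰𝔭𝔦𝔫(8)` of the closed group `H`, as triples `(a₁, a₂, a₃)`: the tangent
vectors all of whose exponentials lie in `H`. -/
def spin8 : Set (EndO × EndO × EndO) :=
  {a | ∀ t : ℝ, (NormedSpace.exp (t • a.1), NormedSpace.exp (t • a.2.1),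
    NormedSpace.exp (t • a.2.2)) ∈ H}

/-! ### Spinors and the group `Spin(10,1)` -/

/-- The spinor space `𝕆⁴`; the coordinates are `(x₁, y₁, x₂, y₂)`. -/
abbrev Spinor : Type := Fin 4 → Octonion

abbrev EndSpinor : Type := Spinor →L[ℝ] Spinor

/-- The endomorphism of `𝕆⁴` given by a 4-by-4 matrix of endomorphisms of `𝕆`. -/
def ofBlocks (M : Matrix (Fin 4) (Fin 4) EndO) : EndSpinor :=
  ContinuousLinearMap.pi fun i => ∑ j, (M i j).comp (ContinuousLinearMap.proj j)

/-- The general element of `𝔰𝔭𝔦𝔫(10)`, for `r ∈ ℝ`, `u, v ∈ 𝕆`, `a = (a₁, a₂, a₃) ∈ 𝔰𝔭𝔦𝔫(8)`. -/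
def spin10Matrix (r : ℝ) (u v : Octonion) (a : EndO × EndO × EndO) : EndSpinor :=
  ofBlocks
    !![a.1,          C * R u,      -(r • 1),     -(C * R v);
       -(C * L u),   a.2.2,        -(C * L v),   r • 1;
       r • 1,        C * R v,      a.1,          C * R u;
       C * L v,      -(r • 1),     -(C * L u),   a.2.2]

/-- `Spin(10)`: the connected subgroup of `GL(𝕆⁴)` with Lie algebra `𝔰𝔭𝔦𝔫(10)`, that is, the
subgroup generated by the exponentials of the elements of `𝔰𝔭𝔦𝔫(10)`. -/
def Spin10 : Subgroup EndSpinorˣ :=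
  Subgroup.closure {g | ∃ (r : ℝ) (u v : Octonion), ∃ a ∈ spin8,
    (g : EndSpinor) = NormedSpace.exp (spin10Matrix r u v a)}

/-- The elements `diag(t I₁₆, t⁻¹ I₁₆)`, `t > 0`. -/
def boosts : Set EndSpinorˣ :=
  {g | ∃ t : ℝ, 0 < t ∧ (g : EndSpinor) = ofBlocks
    !![t • 1, 0,     0,       0;
       0,     t • 1, 0,       0;
       0,     0,     t⁻¹ • 1, 0;
       0,     0,     0,       t⁻¹ • 1]}

/-- `Spin(10,1)`: the subgroup of `GL(𝕆⁴)` generated by `Spin(10)` and the boosts. -/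
def Spin101 : Subgroup EndSpinorˣ :=
  Subgroup.closure ((Spin10 : Set EndSpinorˣ) ∪ boosts)

/-- Parameters `x, y, z ∈ ℝ`, `u, v, w ∈ 𝕆`, `a = (a₁, a₂, a₃) ∈ 𝔰𝔭𝔦𝔫(8)` of an element of
the 55-dimensional Lie algebra `𝔰𝔭𝔦𝔫(10,1)`. -/
structure Spin101Param where
  x : ℝ
  y : ℝ
  z : ℝ
  u : Octonion
  v : Octonion
  w : Octonion
  a : EndO × EndO × EndO
  ha : a ∈ spin8

/-- The element of `𝔰𝔭𝔦𝔫(10,1) ⊆ End(𝕆⁴)` with the given parameters. -/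
def Spin101Param.toSpinor (P : Spin101Param) : EndSpinor :=
  ofBlocks
    !![P.a.1 + P.x • 1,  C * R P.u,           P.y • 1,           C * R P.v;
       -(C * L P.u),     P.a.2.2 + P.x • 1,   C * L P.v,         -(P.y • 1);
       P.z • 1,          C * R P.w,           P.a.1 - P.x • 1,   C * R P.u;
       C * L P.w,        -(P.z • 1),          -(C * L P.u),      P.a.2.2 - P.x • 1]

/-! ### Vectors and the group `SO↑(10,1)` -/

/-- The vector space `ℝ^{2+1} ⊕ 𝕆 = ℝ^{10+1}`, with coordinates `(a₁, a₂, a₃, x)`. -/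
abbrev Vec : Type := ℝ × ℝ × ℝ × Octonion

abbrev EndVec : Type := Vec →L[ℝ] Vec

/-- The Lorentzian inner product `-2 (a₁ b₃ + a₃ b₁) + a₂ b₂ + x · y`. -/
def lor (a b : Vec) : ℝ :=
  -2 * (a.1 * b.2.2.1 + a.2.2.1 * b.1) + a.2.1 * b.2.1 + ⟪a.2.2.2, b.2.2.2⟫

/-- `SO(10,1)`: the linear maps of determinant one that preserve the inner product. -/
def SO101 : Subgroup EndVecˣ where
  carrier := {g | LinearMap.det ((g : EndVec) : Vec →ₗ[ℝ] Vec) = 1 ∧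
    ∀ a b : Vec, lor ((g : EndVec) a) ((g : EndVec) b) = lor a b}
  mul_mem' := by
    rintro g h ⟨hg, hg'⟩ ⟨hh, hh'⟩
    refine ⟨?_, fun a b => ?_⟩
    · rw [Units.val_mul, ContinuousLinearMap.toLinearMap_mul, map_mul, hg, hh, one_mul]
    · rw [Units.val_mul, mul_apply_eq_comp, mul_apply_eq_comp, hg', hh']
  one_mem' := ⟨by simp, fun a b => rfl⟩
  inv_mem' := by
    rintro g ⟨hg, hg'⟩
    have key : ∀ a : Vec, (g : EndVec) (((g⁻¹ : EndVecˣ) : EndVec) a) = a := fun a => by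
      rw [← mul_apply_eq_comp, Units.mul_inv, one_apply_eq_self]
    refine ⟨?_, fun a b => ?_⟩
    · have h : LinearMap.det (((g * g⁻¹ : EndVecˣ) : EndVec) : Vec →ₗ[ℝ] Vec) = 1 := by simp
      rwa [Units.val_mul, ContinuousLinearMap.toLinearMap_mul, map_mul, hg, one_mul] at h
    · rw [← hg', key, key]

/-- `SO↑(10,1)`: the identity component of `SO(10,1)`. -/
def SOUp101 : Subgroup EndVecˣ :=
  (Subgroup.connectedComponentOfOne SO101).map SO101.subtype

/-- The element of `𝔰𝔬(10,1) ⊆ End(ℝ^{2+1} ⊕ 𝕆)` attached to the parameters of an element of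
`𝔰𝔭𝔦𝔫(10,1)`. -/
def Spin101Param.toVec (P : Spin101Param) : EndVec :=
  LinearMap.toContinuousLinearMap
    { toFun := fun b =>
        (2 * P.x * b.1 + P.y * b.2.1 + ⟪C P.v, b.2.2.2⟫,
         2 * P.z * b.1 + 2 * P.y * b.2.2.1 + 2 * ⟪C P.u, b.2.2.2⟫,
         P.z * b.2.1 - 2 * P.x * b.2.2.1 + ⟪C P.w, b.2.2.2⟫,
         (2 * b.1) • C P.w - (2 * b.2.1) • C P.u + (2 * b.2.2.1) • C P.v + P.a.2.1 b.2.2.2)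
      map_add' := fun b c => by
        refine Prod.ext ?_ (Prod.ext ?_ (Prod.ext ?_ ?_))
        · simp [inner_add_right]; ring
        · simp [inner_add_right]; ring
        · simp [inner_add_right]; ring
        · simp only [Prod.fst_add, Prod.snd_add, map_add]; module
      map_smul' := fun t b => by
        refine Prod.ext ?_ (Prod.ext ?_ (Prod.ext ?_ ?_))
        · simp [inner_smul_right]; ring
        · simp [inner_smul_right]; ring
        · simp [inner_smul_right]; ring
        · simp only [Prod.smul_fst, Prod.smul_snd, map_smul, smul_eq_mul, RingHom.id_apply]
          module }

/-- `ρ : Spin(10,1) → SO↑(10,1)` is a homomorphism of Lie groups that induces on Lie algebras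
the map `P.toSpinor ↦ P.toVec`. -/
def InducesOnLieAlgebras (ρ : Spin101 →* SOUp101) : Prop :=
  Continuous ρ ∧ ∀ P : Spin101Param, ∃ g : Spin101,
    ((g : EndSpinorˣ) : EndSpinor) = NormedSpace.exp P.toSpinor ∧
    ((ρ g : EndVecˣ) : EndVec) = NormedSpace.exp P.toVec

/-! ### The squaring map, the quartic invariant and the causal structure -/

/-- The squaring map `σ : 𝕆⁴ → ℝ^{2+1} ⊕ 𝕆`, at `(x₁, y₁, x₂, y₂) = (s 0, s 1, s 2, s 3)`. -/
def squaring (s : Spinor) : Vec :=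
  (‖s 0‖ ^ 2 + ‖s 1‖ ^ 2,
   2 * (⟪s 0, s 2⟫ - ⟪s 1, s 3⟫),
   ‖s 2‖ ^ 2 + ‖s 3‖ ^ 2,
   (2 : ℝ) • (s 0 * s 3 + s 2 * s 1))

/-- The quartic polynomial `p` on `𝕆⁴`. -/
def quartic (s : Spinor) : ℝ :=
  ‖s 0‖ ^ 2 * ‖s 2‖ ^ 2 + ‖s 1‖ ^ 2 * ‖s 3‖ ^ 2 - (⟪s 0, s 2⟫ + ⟪s 1, s 3⟫) ^ 2
    + 2 * ⟪s 0 * s 1, s 2 * s 3⟫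

/-- The timelike vector `(1, 0, 1, 0)` that fixes the time orientation. -/
def timeAxis : Vec := (1, 0, 1, 0)

/-- The forward light cone: the future-directed null vectors. -/
def forwardLightCone : Set Vec := {b | lor b b = 0 ∧ lor b timeAxis < 0}

/-- The future-directed timelike vectors. -/
def futureTimelike : Set Vec := {b | lor b b < 0 ∧ lor b timeAxis < 0}

end Bryant

end

/-!
Write `σ` for the squaring map. It intertwines the one-parameter groups `exp (tA)` and
`exp (tρ'(A))`, because both sides of `σ (exp (tA) z) = exp (tρ'(A)) σ z` solve the same linear
differential equation. Hence every element of `Spin(10,1)` *lifts* an element `h` of `SO↑(10,1)`,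
in the sense that `σ (g z) = h (σ z)`; as the range of `σ` spans, `h` is unique, and `ρ g = h` is
the homomorphism sought.

An element of the kernel preserves `σ`, so it commutes with the Clifford multiplications; a
version of Schur's lemma makes it a scalar, and the scalar is `±1`. Fix a coordinate axis
orthogonal to the time axis. A product of two spatial reflections, one of them along the fixed
axis, is a rotation in a plane through that axis, hence an exponential in the image of `ρ`. By
Cartan–Dieudonné these products generate the spatial rotations, and together with the boosts they
generate `SO↑(10,1)`. A continuous surjective homomorphism from a
σ-compact group with finite kernel is then a covering.

The spatial rotations bring every vector to the form `(p, 0, q, 0)`, whose causal type is read off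
from `p q` and `p + q`; this determines the range of `σ`.
-/

noncomputable section

namespace Bryant

/-! ### Octonion identities -/

theorem exists_quaternion_coord_eq (r i j k : ℝ) :
    ∃ q : ℍ[ℝ], q.re = r ∧ q.imI = i ∧ q.imJ = j ∧ q.imK = k :=
  ⟨⟨r, i, j, k⟩, rfl, rfl, rfl, rfl⟩

theorem quaternion_eq_zero_of_mul_comm {a : ℍ[ℝ]}
    (h : ∀ p q : ℍ[ℝ], a * (p * q) = a * (q * p)) : a = 0 := by
  obtain ⟨i, hi⟩ := exists_quaternion_coord_eq 0 1 0 0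
  obtain ⟨j, hj⟩ := exists_quaternion_coord_eq 0 0 1 0
  by_contra ha
  have hij : (i * j).imK = (j * i).imK := by rw [mul_left_cancel₀ ha (h i j)]
  norm_num [hi, hj] at hij

theorem exists_quaternion_eq_smul_one_of_mul_comm {a : ℍ[ℝ]} (h : ∀ p : ℍ[ℝ], p * a = a * p) :
    ∃ r : ℝ, a = r • 1 := by
  obtain ⟨i, hi⟩ := exists_quaternion_coord_eq 0 1 0 0
  obtain ⟨j, hj⟩ := exists_quaternion_coord_eq 0 0 1 0
  have hia := Quaternion.ext_iff.1 (h i)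
  have hja := Quaternion.ext_iff.1 (h j)
  simp only [Quaternion.re_mul, Quaternion.imI_mul, Quaternion.imJ_mul, Quaternion.imK_mul, hi,
    zero_mul, one_mul, mul_zero, mul_one, zero_add, add_zero, zero_sub, sub_zero, sub_self,
    true_and] at hia
  simp only [Quaternion.re_mul, Quaternion.imI_mul, Quaternion.imJ_mul, Quaternion.imK_mul, hj,
    zero_mul, one_mul, mul_zero, mul_one, zero_add, add_zero, zero_sub, sub_zero, sub_self,
    true_and] at hja
  exact ⟨a.re, by ext <;> simp <;> linarith⟩

namespace Octonion

theorem fst_sub (x y : Octonion) : (x - y).fst = x.fst - y.fst := rfl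

theorem snd_sub (x y : Octonion) : (x - y).snd = x.snd - y.snd := rfl

theorem fst_one : (1 : Octonion).fst = 1 := rfl

theorem snd_one : (1 : Octonion).snd = 0 := rfl

theorem fst_mk (a b : ℍ[ℝ]) : (mk a b).fst = a := rfl

theorem snd_mk (a b : ℍ[ℝ]) : (mk a b).snd = b := rfl

scoped instance : NonAssocRing Octonion where
  left_distrib x y z := (L x).map_add y z
  right_distrib x y z := (R z).map_add x y
  zero_mul x := (R x).map_zero
  mul_zero x := (L x).map_zero
  one_mul x := by apply ext' <;> simp [fst_mul, snd_mul, fst_one, snd_one]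
  mul_one x := by apply ext' <;> simp [fst_mul, snd_mul, fst_one, snd_one]

scoped instance : IsScalarTower ℝ Octonion Octonion := ⟨fun t x y => (R y).map_smul t x⟩

scoped instance : SMulCommClass ℝ Octonion Octonion := ⟨fun t x y => ((L x).map_smul t y).symm⟩

theorem inner_eq_inner_fst_add_inner_snd (x y : Octonion) :
    ⟪x, y⟫ = ⟪x.fst, y.fst⟫ + ⟪x.snd, y.snd⟫ :=
  WithLp.prod_inner_apply x y

scoped instance : NormOneClass Octonion where
  norm_one := by
    rw [← sq_eq_sq₀ (norm_nonneg _) zero_le_one, ← real_inner_self_eq_norm_sq,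
      inner_eq_inner_fst_add_inner_snd, fst_one, snd_one, inner_zero_left,
      real_inner_self_eq_norm_sq, norm_one, add_zero]

theorem C_apply (x : Octonion) : C x = (2 * ⟪1, x⟫) • (1 : Octonion) - x := by
  simp [C, smul_smul]

theorem fst_C (x : Octonion) : (C x).fst = star x.fst := by
  rw [C_apply, fst_sub, fst_smul, inner_eq_inner_fst_add_inner_snd, Quaternion.inner_def,
    fst_one, snd_one, inner_zero_left]
  ext <;> simp
  ring

theorem snd_C (x : Octonion) : (C x).snd = -x.snd := by
  rw [C_apply, snd_sub, snd_smul, snd_one, smul_zero, zero_sub]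

theorem C_C (x : Octonion) : C (C x) = x := by
  apply ext' <;> simp [fst_C, snd_C]

theorem C_mul (x y : Octonion) : C (x * y) = C y * C x := by
  apply ext' <;> simp [fst_C, snd_C, fst_mul, snd_mul, add_comm]

theorem inner_C_C (x y : Octonion) : ⟪C x, C y⟫ = ⟪x, y⟫ := by
  simp [inner_eq_inner_fst_add_inner_snd, Quaternion.inner_def, fst_C, snd_C]

theorem norm_C (x : Octonion) : ‖C x‖ = ‖x‖ := by
  rw [norm_eq_sqrt_real_inner, inner_C_C, ← norm_eq_sqrt_real_inner]

theorem inner_mul_left (x y z : Octonion) : ⟪x * y, z⟫ = ⟪y, C x * z⟫ := by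
  simp [inner_eq_inner_fst_add_inner_snd, Quaternion.inner_def, fst_C, snd_C, fst_mul, snd_mul]
  ring

theorem inner_mul_right (x y z : Octonion) : ⟪x * y, z⟫ = ⟪x, z * C y⟫ := by
  rw [← inner_C_C, C_mul, inner_mul_left, ← inner_C_C (C x), C_mul, C_C, C_C, C_C]

theorem inner_C_mul_right (x y u : Octonion) : ⟪x, C (y * u)⟫ = ⟪C u, x * y⟫ := by
  rw [C_mul, real_inner_comm, inner_mul_right, C_C]

theorem inner_C_mul_left (x y u : Octonion) : ⟪y, C (u * x)⟫ = ⟪C u, x * y⟫ := by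
  rw [C_mul, real_inner_comm, inner_mul_left, C_C]

theorem C_mul_mul (x z : Octonion) : C x * (x * z) = ‖x‖ ^ 2 • z := by
  rw [← real_inner_self_eq_norm_sq, inner_eq_inner_fst_add_inner_snd, Quaternion.inner_def,
    Quaternion.inner_def]
  apply ext' <;> ext <;> simp [fst_C, snd_C, fst_mul, snd_mul, fst_smul, snd_smul] <;> ring

theorem mul_C_mul (x z : Octonion) : x * (C x * z) = ‖x‖ ^ 2 • z := by
  simpa only [C_C, norm_C] using C_mul_mul (C x) z

theorem mul_mul_C (x z : Octonion) : z * x * C x = ‖x‖ ^ 2 • z := by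
  simpa only [C_mul, C_C, map_smul, norm_C] using congrArg C (C_mul_mul (C x) (C z))

theorem mul_C_mul_add (x y z : Octonion) :
    x * (C y * z) + y * (C x * z) = (2 * ⟪x, y⟫) • z := by
  have h := mul_C_mul (x + y) z
  rw [norm_add_sq_real] at h
  simp only [map_add, add_mul, mul_add, mul_C_mul] at h
  linear_combination (norm := module) h

theorem C_mul_mul_add (x y z : Octonion) :
    C x * (y * z) + C y * (x * z) = (2 * ⟪x, y⟫) • z := by
  simpa only [C_C, inner_C_C] using mul_C_mul_add (C x) (C y) z

theorem mul_mul_C_add (x y z : Octonion) : z * y * C x + z * x * C y = (2 * ⟪x, y⟫) • z := by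
  simpa only [map_add, C_mul, C_C, map_smul, inner_C_C] using
    congrArg C (C_mul_mul_add (C x) (C y) (C z))

theorem norm_mul_sq (x y : Octonion) : ‖x * y‖ ^ 2 = ‖x‖ ^ 2 * ‖y‖ ^ 2 := by
  rw [← real_inner_self_eq_norm_sq, inner_mul_left, C_mul_mul, inner_smul_right,
    real_inner_self_eq_norm_sq]

theorem inner_mul_mul_add (x y z w : Octonion) :
    ⟪x * z, y * w⟫ + ⟪x * w, y * z⟫ = 2 * ⟪x, y⟫ * ⟪z, w⟫ := by
  have h := congrArg (fun t => ⟪z, t⟫) (C_mul_mul_add x y w)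
  simp only [inner_add_right, inner_smul_right] at h
  rw [inner_mul_left, real_inner_comm (y * z), inner_mul_left y, h]

theorem exists_eq_smul_one_of_mul_assoc {c : Octonion}
    (h : ∀ x u, c * (x * u) = c * x * u) : ∃ r : ℝ, c = r • 1 := by
  have hc : c.snd = 0 := quaternion_eq_zero_of_mul_comm fun p q => by
    have hpq := congrArg snd (h (mk (star q) 0) (mk (star p) 0))
    simp only [snd_mul, fst_mul, fst_mk, snd_mk, star_mul, star_star, star_zero, zero_mul,
      mul_zero, sub_zero, zero_add] at hpq
    rw [hpq, mul_assoc]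
  obtain ⟨r, hr⟩ := exists_quaternion_eq_smul_one_of_mul_comm (a := c.fst) fun p => by
    simpa [snd_mul, fst_mul, fst_mk, snd_mk, hc] using congrArg snd (h (mk p 0) (mk 0 1))
  refine ⟨r, ext' ?_ ?_⟩
  · rw [hr, fst_smul, fst_one]
  · rw [hc, snd_smul, snd_one, smul_zero]

theorem eq_zero_of_mul_right_comm {c : Octonion}
    (h : ∀ x u, x * u * c = u * (x * c)) : c = 0 := by
  have hc : c.fst = 0 := star_eq_zero.1 <| quaternion_eq_zero_of_mul_comm fun p q => by
    simpa [fst_mul, snd_mul, fst_mk, snd_mk, mul_assoc] using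
      congrArg (star ·.fst) (h (mk (star q) 0) (mk (star p) 0))
  have hswap (p : ℍ[ℝ]) : star c.snd * p = star p * star c.snd := by
    simpa [fst_mul, snd_mul, fst_mk, snd_mk, hc] using congrArg fst (h (mk p 0) (mk 0 1))
  refine ext' hc (star_eq_zero.1 <| quaternion_eq_zero_of_mul_comm fun p q => ?_)
  rw [hswap, star_mul, mul_assoc, ← hswap, ← mul_assoc, ← hswap, mul_assoc]

theorem exists_eq_smul_of_map_mul {f : Octonion → Octonion}
    (h : ∀ x u, f (x * u) = f x * u) : ∃ r : ℝ, ∀ x, f x = r • x := by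
  have hf (x) : f x = f 1 * x := by simpa only [one_mul] using h 1 x
  obtain ⟨r, hr⟩ := exists_eq_smul_one_of_mul_assoc (c := f 1) fun x u => by
    rw [← hf, h, hf x]
  exact ⟨r, fun x => by rw [hf, hr, smul_mul_assoc, one_mul]⟩

theorem eq_zero_of_map_mul_swap {f : Octonion → Octonion}
    (h : ∀ x u, f (x * u) = u * f x) (x : Octonion) : f x = 0 := by
  have hf (x) : f x = x * f 1 := by simpa only [one_mul] using h 1 x
  rw [hf, eq_zero_of_mul_right_comm (c := f 1) fun x u => by rw [← hf, h, hf x], mul_zero]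

end Octonion

/-! ### One-parameter groups -/

section OneParameterGroup

variable {A : Type*} [NormedRing A] [NormedAlgebra ℝ A] [CompleteSpace A]

theorem exp_neg_mul_exp (M : A) : NormedSpace.exp (-M) * NormedSpace.exp M = 1 := by
  let _ : NormedAlgebra ℚ A := NormedAlgebra.restrictScalars ℚ ℝ A
  rw [← NormedSpace.exp_add_of_commute (Commute.refl M).neg_left, neg_add_cancel,
    NormedSpace.exp_zero]

/-- The exponential of an element of a Banach algebra, as a unit with inverse `exp (-M)`. -/
def expUnit (M : A) : Aˣ where
  val := NormedSpace.exp M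
  inv := NormedSpace.exp (-M)
  val_inv := by simpa only [neg_neg] using exp_neg_mul_exp (-M)
  inv_val := exp_neg_mul_exp M

theorem val_expUnit (M : A) : (expUnit M : A) = NormedSpace.exp M := rfl

theorem expUnit_zero : expUnit (0 : A) = 1 :=
  Units.ext NormedSpace.exp_zero

theorem expUnit_add_self (M : A) : expUnit (M + M) = expUnit M * expUnit M := by
  let _ : NormedAlgebra ℚ A := NormedAlgebra.restrictScalars ℚ ℝ A
  exact Units.ext (NormedSpace.exp_add_of_commute (Commute.refl M))

theorem continuous_expUnit : Continuous (expUnit : A → Aˣ) := by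
  let _ : NormedAlgebra ℚ A := NormedAlgebra.restrictScalars ℚ ℝ A
  exact Units.continuous_iff.2 ⟨NormedSpace.exp_continuous,
    NormedSpace.exp_continuous.comp continuous_neg⟩

theorem exp_smul_eq_of_hasDerivAt {N : A} {r : ℝ → A} (h0 : r 0 = 1)
    (hr : ∀ t, HasDerivAt r (N * r t) t) (t : ℝ) : NormedSpace.exp (t • N) = r t := by
  have hd (t : ℝ) : HasDerivAt (fun t : ℝ => NormedSpace.exp (t • -N) * r t) 0 t :=
    ((hasDerivAt_exp_smul_const (-N) t).mul (hr t)).congr_deriv (by noncomm_ring)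
  have hc := is_const_of_deriv_eq_zero (fun t => (hd t).differentiableAt)
    (fun t => (hd t).deriv) t 0
  rw [zero_smul, NormedSpace.exp_zero, h0, one_mul, smul_neg] at hc
  exact eq_of_sub_eq_zero <| (expUnit (-(t • N))).isUnit.mul_right_eq_zero.1 <| by
    rw [mul_sub, val_expUnit, hc, exp_neg_mul_exp, sub_self]

theorem exp_smul_of_cube_eq_neg {N : A} (hN : N * (N * N) = -N) (t : ℝ) :
    NormedSpace.exp (t • N) = 1 + Real.sin t • N + (1 - Real.cos t) • (N * N) := by
  refine exp_smul_eq_of_hasDerivAt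
    (r := fun t => 1 + Real.sin t • N + (1 - Real.cos t) • (N * N)) (by simp) (fun t => ?_) t
  refine ((((Real.hasDerivAt_sin t).smul_const N).const_add 1).add
    (((Real.hasDerivAt_cos t).const_sub 1).smul_const (N * N))).congr_deriv ?_
  simp only [mul_add, mul_one, mul_smul_comm, hN]
  module

theorem exp_pi_smul_of_sq_eq_neg_one {N : A} (hN : N * N = -1) :
    NormedSpace.exp (Real.pi • N) = -1 := by
  rw [exp_smul_of_cube_eq_neg (by rw [hN, mul_neg_one]), hN, Real.sin_pi, Real.cos_pi]
  module

theorem exp_smul_of_sq_eq_one {N : A} (hN : N * N = 1) (t : ℝ) :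
    NormedSpace.exp (t • N) = Real.cosh t • 1 + Real.sinh t • N := by
  refine exp_smul_eq_of_hasDerivAt (r := fun t => Real.cosh t • 1 + Real.sinh t • N)
    (by simp) (fun t => ?_) t
  refine (((Real.hasDerivAt_cosh t).smul_const (1 : A)).add
    ((Real.hasDerivAt_sinh t).smul_const N)).congr_deriv ?_
  simp only [mul_add, mul_one, mul_smul_comm, hN]
  module

end OneParameterGroup

section Flow

variable {E F : Type*} [NormedAddCommGroup E] [NormedSpace ℝ E] [CompleteSpace E]
  [NormedAddCommGroup F] [NormedSpace ℝ F] [CompleteSpace F]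

theorem hasDerivAt_exp_smul_apply (M : E →L[ℝ] E) (v : E) (t : ℝ) :
    HasDerivAt (fun t : ℝ => NormedSpace.exp (t • M) v) (M (NormedSpace.exp (t • M) v)) t := by
  simpa using (hasDerivAt_exp_smul_const' M t).clm_apply (hasDerivAt_const t v)

theorem hasDerivAt_exp_smul_apply_zero (M : E →L[ℝ] E) (v : E) :
    HasDerivAt (fun t : ℝ => NormedSpace.exp (t • M) v) (M v) 0 := by
  simpa using hasDerivAt_exp_smul_apply M v 0

theorem map_exp_apply {f : E → F} {f' : E → E →L[ℝ] F} {M : E →L[ℝ] E} {N : F →L[ℝ] F}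
    (hf : ∀ v, HasFDerivAt f (f' v) v) (hMN : ∀ v, f' v (M v) = N (f v)) (v : E) :
    f (NormedSpace.exp M v) = NormedSpace.exp N (f v) := by
  have hd (t : ℝ) : HasDerivAt (fun t : ℝ => NormedSpace.exp (t • -N)
      (f (NormedSpace.exp (t • M) v))) 0 t := by
    refine ((hasDerivAt_exp_smul_const (-N) t).clm_apply
      ((hf _).comp_hasDerivAt t (hasDerivAt_exp_smul_apply M v t))).congr_deriv ?_
    simp [hMN, mul_apply_eq_comp]
  have hc := is_const_of_deriv_eq_zero (fun t => (hd t).differentiableAt)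
    (fun t => (hd t).deriv) 1 0
  rw [one_smul, one_smul, zero_smul, zero_smul, NormedSpace.exp_zero, NormedSpace.exp_zero,
    one_apply_eq_self, one_apply_eq_self] at hc
  have hN : NormedSpace.exp N * NormedSpace.exp (-N) = 1 := (expUnit N).mul_inv
  rw [← hc, ← mul_apply_eq_comp, hN, one_apply_eq_self]

end Flow

/-! ### Infinitesimal equivariance of the squaring map -/

open Octonion

theorem inner_apply_add_inner_apply_eq_zero_of_norm_exp {E : Type*} [NormedAddCommGroup E]
    [InnerProductSpace ℝ E] [CompleteSpace E] {b : E →L[ℝ] E}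
    (hb : ∀ (t : ℝ) x, ‖NormedSpace.exp (t • b) x‖ = ‖x‖) (x y : E) :
    ⟪b x, y⟫ + ⟪x, b y⟫ = 0 := by
  have hself (x : E) : ⟪x, b x⟫ = 0 := by
    have h := (hasDerivAt_exp_smul_apply_zero b x).norm_sq
    simp only [hb, zero_smul, NormedSpace.exp_zero, one_apply_eq_self] at h
    linarith [h.unique (hasDerivAt_const 0 (‖x‖ ^ 2))]
  have h := hself (x + y)
  simp only [map_add, inner_add_left, inner_add_right, hself] at h
  rw [real_inner_comm (b x) y] at h
  linarith

section Spin8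

variable {a : EndO × EndO × EndO} (ha : a ∈ spin8)
include ha

theorem spin8_skew_fst (x y : Octonion) : ⟪a.1 x, y⟫ + ⟪x, a.1 y⟫ = 0 :=
  inner_apply_add_inner_apply_eq_zero_of_norm_exp (fun t => (ha t).1.1) x y

theorem spin8_skew_snd (x y : Octonion) : ⟪a.2.1 x, y⟫ + ⟪x, a.2.1 y⟫ = 0 :=
  inner_apply_add_inner_apply_eq_zero_of_norm_exp (fun t => (ha t).2.1.1) x y

theorem spin8_skew_thd (x y : Octonion) : ⟪a.2.2 x, y⟫ + ⟪x, a.2.2 y⟫ = 0 :=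
  inner_apply_add_inner_apply_eq_zero_of_norm_exp (fun t => (ha t).2.2.1.1) x y

theorem spin8_mul (x y : Octonion) : a.2.1 (x * y) = x * a.2.2 y + a.1 x * y := by
  have h := ((LinearMap.mul ℝ Octonion).toContinuousBilinearMap.hasFDerivAt_of_bilinear
    (hasDerivAt_exp_smul_apply_zero a.1 x).hasFDerivAt
    (hasDerivAt_exp_smul_apply_zero a.2.2 y).hasFDerivAt).hasDerivAt
  have htriality (t : ℝ) : NormedSpace.exp (t • a.1) x * NormedSpace.exp (t • a.2.2) y =
      NormedSpace.exp (t • a.2.1) (x * y) := ((ha t).2.2.2 x y).symm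
  simp only [LinearMap.toContinuousBilinearMap_apply, LinearMap.mul_apply', htriality] at h
  simpa using (hasDerivAt_exp_smul_apply_zero a.2.1 (x * y)).unique h

end Spin8

theorem zero_mem_spin8 : (0 : EndO × EndO × EndO) ∈ spin8 := by
  intro t
  have h : IsSO 1 := ⟨fun x => rfl, by simp⟩
  simpa [H] using h

/-- The differential `dσ_s(d)` of the squaring map. As `σ` is quadratic, it is a symmetric
bilinear function of `(s, d)` with `dσ_s(s) = 2 σ(s)`. -/
def dsquaring : Spinor →L[ℝ] Spinor →L[ℝ] Vec :=
  LinearMap.toContinuousBilinearMap <| LinearMap.mk₂ ℝ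
    (fun s d =>
      (2 * (⟪s 0, d 0⟫ + ⟪s 1, d 1⟫),
       2 * (⟪s 0, d 2⟫ + ⟪s 2, d 0⟫ - (⟪s 1, d 3⟫ + ⟪s 3, d 1⟫)),
       2 * (⟪s 2, d 2⟫ + ⟪s 3, d 3⟫),
       (2 : ℝ) • (s 0 * d 3 + d 0 * s 3 + (s 2 * d 1 + d 2 * s 1))))
    (fun s s' d => by
      simp only [Pi.add_apply, inner_add_left, mul_add, add_mul, Prod.ext_iff,
        Prod.fst_add, Prod.snd_add]
      exact ⟨by ring, by ring, by ring, by module⟩)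
    (fun c s d => by
      simp only [Pi.smul_apply, real_inner_smul_left, smul_mul_assoc, mul_smul_comm, Prod.ext_iff,
        Prod.smul_fst, Prod.smul_snd, smul_eq_mul]
      exact ⟨by ring, by ring, by ring, by module⟩)
    (fun s d d' => by
      simp only [Pi.add_apply, inner_add_right, mul_add, add_mul, Prod.ext_iff,
        Prod.fst_add, Prod.snd_add]
      exact ⟨by ring, by ring, by ring, by module⟩)
    (fun c s d => by
      simp only [Pi.smul_apply, real_inner_smul_right, smul_mul_assoc, mul_smul_comm, Prod.ext_iff,
        Prod.smul_fst, Prod.smul_snd, smul_eq_mul]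
      exact ⟨by ring, by ring, by ring, by module⟩)

theorem dsquaring_apply (s d : Spinor) : dsquaring s d =
    (2 * (⟪s 0, d 0⟫ + ⟪s 1, d 1⟫),
     2 * (⟪s 0, d 2⟫ + ⟪s 2, d 0⟫ - (⟪s 1, d 3⟫ + ⟪s 3, d 1⟫)),
     2 * (⟪s 2, d 2⟫ + ⟪s 3, d 3⟫),
     (2 : ℝ) • (s 0 * d 3 + d 0 * s 3 + (s 2 * d 1 + d 2 * s 1))) := rfl

theorem dsquaring_comm (s d : Spinor) : dsquaring s d = dsquaring d s := by
  simp only [dsquaring_apply, real_inner_comm (s _), Prod.ext_iff]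
  exact ⟨trivial, by ring, trivial, by module⟩

theorem dsquaring_self (s : Spinor) : dsquaring s s = (2 : ℝ) • squaring s := by
  simp only [dsquaring_apply, squaring, real_inner_comm (s 0) (s 2), real_inner_comm (s 1) (s 3),
    real_inner_self_eq_norm_sq, Prod.smul_mk, smul_eq_mul, Prod.ext_iff]
  exact ⟨trivial, by ring, trivial, by module⟩

theorem squaring_add (s d : Spinor) :
    squaring (s + d) = squaring s + dsquaring s d + squaring d := by
  have h := dsquaring_self (s + d)
  simp only [map_add, add_apply, dsquaring_self, dsquaring_comm d s] at h
  linear_combination (norm := module) -(1 / 2 : ℝ) • h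

theorem hasFDerivAt_squaring (s : Spinor) : HasFDerivAt squaring (dsquaring s) s := by
  have h : squaring = fun s => (1 / 2 : ℝ) • dsquaring s s := by
    funext s
    rw [dsquaring_self, smul_smul]
    norm_num
  rw [h]
  refine ((dsquaring.hasFDerivAt_of_bilinear (hasFDerivAt_id s)
    (hasFDerivAt_id s)).const_smul (1 / 2 : ℝ)).congr_fderiv ?_
  ext1 d
  simp only [id_eq, ContinuousLinearMap.precompR_apply, ContinuousLinearMap.compL_apply,
    ContinuousLinearMap.comp_id, add_apply, smul_apply, ContinuousLinearMap.precompL_apply,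
    ContinuousLinearMap.id_apply, dsquaring_comm d s]
  module

theorem continuous_squaring : Continuous squaring :=
  continuous_iff_continuousAt.2 fun s => (hasFDerivAt_squaring s).continuousAt

theorem ofBlocks_apply (M : Matrix (Fin 4) (Fin 4) EndO) (s : Spinor) (i : Fin 4) :
    ofBlocks M s i = M i 0 (s 0) + M i 1 (s 1) + M i 2 (s 2) + M i 3 (s 3) := by
  simp [ofBlocks, Fin.sum_univ_four]

namespace Spin101Param

variable (P : Spin101Param) (s : Spinor)

theorem toSpinor_apply_zero : P.toSpinor s 0 =
    P.a.1 (s 0) + P.x • s 0 + C (s 1 * P.u) + P.y • s 2 + C (s 3 * P.v) := by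
  rw [toSpinor, ofBlocks_apply]
  simp [mul_apply_eq_comp, R]

theorem toSpinor_apply_one : P.toSpinor s 1 =
    -C (P.u * s 0) + (P.a.2.2 (s 1) + P.x • s 1) + C (P.v * s 2) - P.y • s 3 := by
  rw [toSpinor, ofBlocks_apply]
  simp [mul_apply_eq_comp, L, sub_eq_add_neg]

theorem toSpinor_apply_two : P.toSpinor s 2 =
    P.z • s 0 + C (s 1 * P.w) + (P.a.1 (s 2) - P.x • s 2) + C (s 3 * P.u) := by
  rw [toSpinor, ofBlocks_apply]
  simp [mul_apply_eq_comp, R]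

theorem toSpinor_apply_three : P.toSpinor s 3 =
    C (P.w * s 0) - P.z • s 1 - C (P.u * s 2) + (P.a.2.2 (s 3) - P.x • s 3) := by
  rw [toSpinor, ofBlocks_apply]
  simp [mul_apply_eq_comp, L, sub_eq_add_neg]

theorem toVec_apply (b : Vec) : P.toVec b =
    (2 * P.x * b.1 + P.y * b.2.1 + ⟪C P.v, b.2.2.2⟫,
     2 * P.z * b.1 + 2 * P.y * b.2.2.1 + 2 * ⟪C P.u, b.2.2.2⟫,
     P.z * b.2.1 - 2 * P.x * b.2.2.1 + ⟪C P.w, b.2.2.2⟫,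
     (2 * b.1) • C P.w - (2 * b.2.1) • C P.u + (2 * b.2.2.1) • C P.v + P.a.2.1 b.2.2.2) := rfl

theorem dsquaring_toSpinor_snd_snd_snd :
    (dsquaring s (P.toSpinor s)).2.2.2 = (P.toVec (squaring s)).2.2.2 := by
  have h2 := spin8_mul P.ha
  have hw₁ := mul_C_mul (s 0) (C P.w)
  have hv₁ := mul_C_mul (s 2) (C P.v)
  have hw₂ := mul_mul_C (C (s 1)) (C P.w)
  have hv₂ := mul_mul_C (C (s 3)) (C P.v)
  have hu₁ := mul_C_mul_add (s 0) (s 2) (C P.u)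
  have hu₂ := mul_mul_C_add (C (s 1)) (C (s 3)) (C P.u)
  rw [C_C, norm_C] at hw₂ hv₂
  rw [C_C, C_C, inner_C_C] at hu₂
  simp only [dsquaring_apply, squaring, toVec_apply, toSpinor_apply_zero, toSpinor_apply_one,
    toSpinor_apply_two, toSpinor_apply_three, C_mul, mul_add, add_mul, mul_sub, sub_mul, mul_neg,
    smul_mul_assoc, mul_smul_comm, map_smul, map_add, h2]
  linear_combination (norm := module)
    (2 : ℝ) • (hw₁ + hv₁ + hw₂ + hv₂ - hu₁ + hu₂)

theorem dsquaring_toSpinor : dsquaring s (P.toSpinor s) = P.toVec (squaring s) := by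
  have h1 := spin8_skew_fst P.ha
  have h3 := spin8_skew_thd P.ha
  have h1_self (x : Octonion) : ⟪x, P.a.1 x⟫ = 0 := by
    linarith [h1 x x, real_inner_comm (P.a.1 x) x]
  have h3_self (x : Octonion) : ⟪x, P.a.2.2 x⟫ = 0 := by
    linarith [h3 x x, real_inner_comm (P.a.2.2 x) x]
  refine Prod.ext ?_ (Prod.ext ?_ (Prod.ext ?_ (P.dsquaring_toSpinor_snd_snd_snd s))) <;>
    simp only [dsquaring_apply, squaring, toVec_apply, toSpinor_apply_zero, toSpinor_apply_one,
      toSpinor_apply_two, toSpinor_apply_three, inner_add_right, inner_sub_right,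
      inner_smul_right, inner_neg_right, h1_self, h3_self,
      inner_C_mul_right _ _ P.u, inner_C_mul_left _ _ P.u, inner_C_mul_right _ _ P.v,
      inner_C_mul_left _ _ P.v, inner_C_mul_right _ _ P.w, inner_C_mul_left _ _ P.w,
      real_inner_self_eq_norm_sq, real_inner_comm (s 0) (s 2), real_inner_comm (s 1) (s 3)]
  · ring
  · have hr1 := real_inner_comm (P.a.1 (s 0)) (s 2)
    have hr3 := real_inner_comm (P.a.2.2 (s 1)) (s 3)
    linear_combination 2 * h1 (s 0) (s 2) - 2 * h3 (s 1) (s 3) + 2 * hr1 - 2 * hr3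
  · ring

theorem squaring_exp :
    squaring (NormedSpace.exp P.toSpinor s) = NormedSpace.exp P.toVec (squaring s) :=
  map_exp_apply hasFDerivAt_squaring P.dsquaring_toSpinor s

end Spin101Param

/-! ### The Lorentz form -/

theorem det_sq_eq_one_of_nondegenerate {K V : Type*} [Field K] [AddCommGroup V] [Module K V]
    [FiniteDimensional K V] {B : LinearMap.BilinForm K V} (hB : B.Nondegenerate) {f : V →ₗ[K] V}
    (hf : ∀ x y, B (f x) (f y) = B x y) : LinearMap.det f ^ 2 = 1 := by
  let b := Module.finBasis K V
  have hcomp : B.comp f f = B := LinearMap.ext₂ hf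
  have hdet := congrArg Matrix.det (LinearMap.BilinForm.toMatrix_comp b b B f f)
  rw [hcomp, Matrix.det_mul, Matrix.det_mul, Matrix.det_transpose, LinearMap.det_toMatrix] at hdet
  refine mul_left_cancel₀ ((LinearMap.BilinForm.nondegenerate_iff_det_ne_zero b).1 hB) ?_
  linear_combination -hdet

/-- The Lorentzian inner product `lor` as a bilinear form. -/
def lorBilin : LinearMap.BilinForm ℝ Vec :=
  LinearMap.mk₂ ℝ lor
    (fun a b c => by simp only [lor, Prod.fst_add, Prod.snd_add, inner_add_left]; ring)
    (fun t a b => by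
      simp only [lor, Prod.smul_fst, Prod.smul_snd, smul_eq_mul, real_inner_smul_left]; ring)
    (fun a b c => by simp only [lor, Prod.fst_add, Prod.snd_add, inner_add_right]; ring)
    (fun t a b => by
      simp only [lor, Prod.smul_fst, Prod.smul_snd, smul_eq_mul, real_inner_smul_right]; ring)

theorem lorBilin_apply (a b : Vec) : lorBilin a b = lor a b := rfl

theorem lor_comm (a b : Vec) : lor a b = lor b a := by
  simp only [lor, real_inner_comm b.2.2.2]; ring

theorem lor_add_self (a b : Vec) : lor (a + b) (a + b) = lor a a + 2 * lor a b + lor b b := by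
  simp only [← lorBilin_apply, map_add, LinearMap.add_apply]
  rw [lorBilin_apply b a, lor_comm, ← lorBilin_apply]
  ring

theorem continuous_lor : Continuous fun p : Vec × Vec => lor p.1 p.2 := by
  unfold lor; fun_prop

theorem lorBilin_nondegenerate : lorBilin.Nondegenerate := by
  have h : lorBilin.SeparatingLeft := by
    rintro ⟨p, t, q, x⟩ h
    have hp : p = 0 := by simpa [lorBilin_apply, lor] using h (0, 0, 1, 0)
    have ht : t = 0 := by simpa [lorBilin_apply, lor] using h (0, 1, 0, 0)
    have hq : q = 0 := by simpa [lorBilin_apply, lor] using h (1, 0, 0, 0)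
    have hx : x = 0 := by simpa [lorBilin_apply, lor] using h (0, 0, 0, x)
    rw [hp, ht, hq, hx]
    rfl
  exact ⟨h, fun y hy => h y fun x => by rw [lorBilin_apply, lor_comm]; exact hy x⟩

theorem lor_map_map_of_self {h : EndVec} (hh : ∀ a, lor (h a) (h a) = lor a a) (a b : Vec) :
    lor (h a) (h b) = lor a b := by
  have hab := hh (a + b)
  rw [map_add, lor_add_self, lor_add_self, hh, hh] at hab
  linarith

theorem hasFDerivAt_lor_self (a : Vec) :
    HasFDerivAt (fun a => lor a a) ((2 : ℝ) • LinearMap.toContinuousLinearMap (lorBilin a)) a := by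
  refine ((lorBilin.toContinuousBilinearMap).hasFDerivAt_of_bilinear (hasFDerivAt_id a)
    (hasFDerivAt_id a)).congr_fderiv (ContinuousLinearMap.ext fun b => ?_)
  change lor a b + lor b a = 2 * lor a b
  rw [lor_comm b]
  ring

namespace Spin101Param

variable (P : Spin101Param)

theorem lor_self_toVec (a : Vec) : lor a (P.toVec a) = 0 := by
  have h2 := spin8_skew_snd P.ha a.2.2.2 a.2.2.2
  rw [real_inner_comm] at h2
  simp only [lor, toVec_apply, inner_add_right, inner_sub_right, real_inner_smul_right,
    real_inner_comm a.2.2.2 (C _)]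
  linear_combination h2 / 2

theorem lor_exp_smul (t : ℝ) (a b : Vec) :
    lor (NormedSpace.exp (t • P.toVec) a) (NormedSpace.exp (t • P.toVec) b) = lor a b := by
  refine lor_map_map_of_self (fun a => ?_) a b
  have h := map_exp_apply (M := t • P.toVec) (N := 0) hasFDerivAt_lor_self
    (fun a => by
      change 2 * lorBilin a (t • P.toVec a) = 0
      rw [map_smul, lorBilin_apply, P.lor_self_toVec, smul_zero, mul_zero]) a
  rwa [NormedSpace.exp_zero, one_apply_eq_self] at h

theorem expUnit_smul_toVec_mem_SO101 (t : ℝ) : expUnit (t • P.toVec) ∈ SO101 := by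
  refine ⟨?_, P.lor_exp_smul t⟩
  rw [← add_halves t, add_smul, expUnit_add_self, Units.val_mul,
    ContinuousLinearMap.toLinearMap_mul, map_mul, ← sq]
  exact det_sq_eq_one_of_nondegenerate lorBilin_nondegenerate (P.lor_exp_smul (t / 2))

theorem expUnit_toVec_mem_SOUp101 : expUnit P.toVec ∈ SOUp101 := by
  let path (t : ℝ) : SO101 := ⟨expUnit (t • P.toVec), P.expUnit_smul_toVec_mem_SO101 t⟩
  have hpath : Continuous path :=
    (continuous_expUnit.comp (continuous_id.smul continuous_const)).subtype_mk _
  have h0 : path 0 = 1 := Subtype.ext (by simp only [path, zero_smul, expUnit_zero]; rfl)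
  exact ⟨path 1, (isPreconnected_range hpath).subset_connectedComponent ⟨0, h0⟩ ⟨1, rfl⟩,
    by simp only [path, one_smul]; rfl⟩

end Spin101Param

/-! ### Lifts -/

/-- `g` lifts `h` if it acts on spinors as `h` acts on their squares: the equivariance that
characterises `h = ρ(g)`. -/
def Lifts (g : EndSpinorˣ) (h : EndVecˣ) : Prop :=
  ∀ s : Spinor, squaring (g • s) = h • squaring s

theorem lifts_one : Lifts 1 1 := fun s => by rw [one_smul, one_smul]

theorem Lifts.mul {g₁ g₂ : EndSpinorˣ} {h₁ h₂ : EndVecˣ} (hg₁ : Lifts g₁ h₁)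
    (hg₂ : Lifts g₂ h₂) : Lifts (g₁ * g₂) (h₁ * h₂) := fun s => by
  rw [mul_smul, hg₁, hg₂, mul_smul]

theorem Lifts.inv {g : EndSpinorˣ} {h : EndVecˣ} (hg : Lifts g h) : Lifts g⁻¹ h⁻¹ := fun s => by
  rw [eq_inv_smul_iff, ← hg, smul_inv_smul]

theorem Spin101Param.lifts_expUnit (P : Spin101Param) :
    Lifts (expUnit P.toSpinor) (expUnit P.toVec) :=
  P.squaring_exp

theorem span_range_squaring : Submodule.span ℝ (Set.range squaring) = ⊤ := by
  rw [Submodule.eq_top_iff']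
  rintro ⟨p, t, q, x⟩
  have hmem (c : ℝ) (s : Spinor) : c • squaring s ∈ Submodule.span ℝ (Set.range squaring) :=
    Submodule.smul_mem _ c (Submodule.subset_span ⟨s, rfl⟩)
  have hdecomp : ((p, t, q, x) : Vec) = (p - t / 2 - ‖x‖ ^ 2 / 2) • squaring ![1, 0, 0, 0]
      + (q - t / 2 - 1 / 2) • squaring ![0, 0, 1, 0] + (t / 2) • squaring ![1, 0, 1, 0]
      + (1 / 2 : ℝ) • squaring ![x, 0, 0, 1] := by
    refine Prod.ext ?_ (Prod.ext ?_ (Prod.ext ?_ ?_)) <;> simp [squaring] <;> ring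
  rw [hdecomp]
  exact add_mem (add_mem (add_mem (hmem _ _) (hmem _ _)) (hmem _ _)) (hmem _ _)

theorem Lifts.unique {g : EndSpinorˣ} {h₁ h₂ : EndVecˣ} (hg₁ : Lifts g h₁) (hg₂ : Lifts g h₂) :
    h₁ = h₂ := by
  refine Units.ext (ContinuousLinearMap.coe_injective (LinearMap.ext_on span_range_squaring ?_))
  rintro _ ⟨s, rfl⟩
  exact (hg₁ s).symm.trans (hg₂ s)

theorem continuous_of_lifts {X : Type*} [TopologicalSpace X] {g : X → EndSpinorˣ}
    {h : X → EndVecˣ} (hg : Continuous g) (hgh : ∀ x, Lifts (g x) (h x)) : Continuous h := by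
  have hval {g : X → EndSpinorˣ} {h : X → EndVecˣ} (hg : Continuous g)
      (hgh : ∀ x, Lifts (g x) (h x)) : Continuous fun x => (h x : EndVec) := by
    refine continuous_clm_apply.2 fun b => ?_
    have hb : b ∈ Submodule.span ℝ (Set.range squaring) := span_range_squaring ▸ Submodule.mem_top
    induction hb using Submodule.span_induction with
    | mem b hb =>
      obtain ⟨s, rfl⟩ := hb
      refine (continuous_squaring.comp
        ((Units.continuous_val.comp hg).clm_apply (continuous_const (y := s)))).congr ?_
      exact fun x => hgh x s
    | zero => simpa only [map_zero] using continuous_const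
    | add b c _ _ hb hc =>
      simp only [map_add]
      exact hb.add hc
    | smul t b _ hb =>
      simp only [map_smul]
      exact hb.const_smul t
  exact Units.continuous_iff.2 ⟨hval hg hgh, hval hg.inv fun x => (hgh x).inv⟩

/-- The group of the spinor transformations that lift an element of `SO↑(10,1)`. -/
def liftGroup : Subgroup EndSpinorˣ where
  carrier := {g | ∃ h ∈ SOUp101, Lifts g h}
  mul_mem' := by
    rintro _ _ ⟨h₁, hh₁, hg₁⟩ ⟨h₂, hh₂, hg₂⟩
    exact ⟨h₁ * h₂, mul_mem hh₁ hh₂, hg₁.mul hg₂⟩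
  one_mem' := ⟨1, one_mem _, lifts_one⟩
  inv_mem' := by
    rintro _ ⟨h, hh, hg⟩
    exact ⟨h⁻¹, inv_mem hh, hg.inv⟩

/-! ### Clifford multiplication and the kernel -/

/-- The standard inner product of the spinor space `𝕆⁴`. -/
def spinorInner (s d : Spinor) : ℝ := ∑ i, ⟪s i, d i⟫

theorem eq_of_spinorInner_left {s d : Spinor} (h : ∀ q, spinorInner q s = spinorInner q d) :
    s = d := by
  have h0 : ∑ i, ‖s i - d i‖ ^ 2 = 0 := by
    simpa only [spinorInner, ← Finset.sum_sub_distrib, ← inner_sub_right, Pi.sub_apply,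
      real_inner_self_eq_norm_sq] using sub_eq_zero.2 (h (s - d))
  rw [Finset.sum_eq_zero_iff_of_nonneg fun i _ => sq_nonneg _] at h0
  funext i
  simpa [sub_eq_zero] using h0 i (Finset.mem_univ i)

/-- Clifford multiplication by a vector: the symmetric operator on spinors with
`2 ⟨s, b d⟩ = b · dσ_s(d)`, the dot being the positive definite inner product of coordinates.
The vector `timeAxis` acts as the identity. -/
def cliffordMul (b : Vec) (s : Spinor) : Spinor :=
  ![b.1 • s 0 + b.2.1 • s 2 + b.2.2.2 * C (s 3),
    b.1 • s 1 - b.2.1 • s 3 + C (s 2) * b.2.2.2,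
    b.2.2.1 • s 2 + b.2.1 • s 0 + b.2.2.2 * C (s 1),
    b.2.2.1 • s 3 - b.2.1 • s 1 + C (s 0) * b.2.2.2]

theorem spinorInner_cliffordMul (b : Vec) (s d : Spinor) :
    spinorInner s (cliffordMul b d) =
      (b.1 * (dsquaring s d).1 + b.2.1 * (dsquaring s d).2.1 +
        b.2.2.1 * (dsquaring s d).2.2.1 + ⟪b.2.2.2, (dsquaring s d).2.2.2⟫) / 2 := by
  simp only [spinorInner, Fin.sum_univ_four, cliffordMul, dsquaring_apply, Matrix.cons_val,
    inner_add_right, inner_sub_right, inner_smul_right,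
    real_inner_comm _ b.2.2.2, inner_add_left, real_inner_smul_left, inner_mul_right (s 0),
    inner_mul_left (d 0), inner_mul_right (s 2), inner_mul_left (d 2)]
  ring

theorem cliffordMul_timeAxis (s : Spinor) : cliffordMul timeAxis s = s := by
  funext i
  fin_cases i <;> simp [cliffordMul, timeAxis]

section Schur

variable {k : Spinor →ₗ[ℝ] Spinor} (hk : ∀ b s, k (cliffordMul b s) = cliffordMul b (k s))
include hk

theorem apply_upper_of_commute_cliffordMul (x y : Octonion) :
    k ![x, y, 0, 0] = ![k ![x, y, 0, 0] 0, k ![x, y, 0, 0] 1, 0, 0] := by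
  have hproj (s : Spinor) : cliffordMul (1, 0, 0, 0) s = ![s 0, s 1, 0, 0] := by
    simp [cliffordMul]
  have h := hk (1, 0, 0, 0) ![x, y, 0, 0]
  rwa [hproj, hproj] at h

theorem apply_twist_of_commute_cliffordMul (x u : Octonion) : k ![0, x * u, 0, 0] =
    ![-(u * C (k ![C x, 0, 0, 0] 1)), C (k ![C x, 0, 0, 0] 0) * u, 0, 0] := by
  have htwist (x y u : Octonion) : cliffordMul (0, 0, 0, u) (cliffordMul (0, 1, 0, 0)
      ![x, y, 0, 0]) = ![-(u * C y), C x * u, 0, 0] := by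
    simp [cliffordMul]
  have h := hk (0, 0, 0, u) (cliffordMul (0, 1, 0, 0) ![C x, 0, 0, 0])
  rw [hk (0, 1, 0, 0), apply_upper_of_commute_cliffordMul hk, htwist, htwist] at h
  simpa only [map_zero, mul_zero, neg_zero, C_C] using h

theorem exists_eq_smul_upper_of_commute_cliffordMul :
    ∃ r : ℝ, ∀ x y, k ![x, y, 0, 0] = r • ![x, y, 0, 0] := by
  have htwist := apply_twist_of_commute_cliffordMul hk
  let β (y : Octonion) := k ![0, y, 0, 0] 0
  let δ (y : Octonion) := k ![0, y, 0, 0] 1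
  have hβ (x) : β x = -C (k ![C x, 0, 0, 0] 1) := by
    simpa [β] using congrFun (htwist x 1) 0
  have hδ (x) : δ x = C (k ![C x, 0, 0, 0] 0) := by
    simpa [δ] using congrFun (htwist x 1) 1
  obtain ⟨r, hr⟩ := exists_eq_smul_of_map_mul (f := δ) fun x u => by
    rw [hδ x]
    exact congrFun (htwist x u) 1
  have hβ0 := eq_zero_of_map_mul_swap (f := β) fun x u => by
    rw [hβ x, mul_neg]
    exact congrFun (htwist x u) 0
  have hα (x) : k ![x, 0, 0, 0] 0 = r • x := by
    rw [← C_C (k _ 0), ← C_C x, ← hδ, hr, map_smul, C_C]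
  have hγ (x) : k ![x, 0, 0, 0] 1 = 0 := by
    rw [← C_C (k _ 1), ← C_C x, ← neg_eq_zero, ← map_neg, ← hβ, hβ0, map_zero]
  refine ⟨r, fun x y => ?_⟩
  have hadd : (![x, y, 0, 0] : Spinor) = ![x, 0, 0, 0] + ![0, y, 0, 0] := by simp
  rw [hadd, map_add, apply_upper_of_commute_cliffordMul hk x 0,
    apply_upper_of_commute_cliffordMul hk 0 y, hα, hγ]
  change ![r • x, 0, 0, 0] + ![β y, δ y, 0, 0] = _
  rw [hr, hβ0]
  simp

theorem exists_eq_smul_of_commute_cliffordMul : ∃ r : ℝ, ∀ s, k s = r • s := by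
  obtain ⟨r, hr⟩ := exists_eq_smul_upper_of_commute_cliffordMul hk
  refine ⟨r, fun s => ?_⟩
  have hs : s = ![s 0, s 1, 0, 0] + cliffordMul (0, 1, 0, 0) ![s 2, -s 3, 0, 0] := by
    funext i
    fin_cases i <;> simp [cliffordMul]
  rw [hs, map_add, hk, hr, hr]
  funext i
  fin_cases i <;> simp [cliffordMul]

end Schur

section Kernel

variable {k : EndSpinorˣ} (hk : Lifts k 1)
include hk

theorem Lifts.dsquaring_smul_smul (s d : Spinor) :
    dsquaring (k • s) (k • d) = dsquaring s d := by
  have h := hk (s + d)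
  rw [smul_add, one_smul, squaring_add, squaring_add, hk, hk, one_smul, one_smul] at h
  exact add_left_cancel (add_right_cancel h)

theorem Lifts.smul_cliffordMul (b : Vec) (s : Spinor) :
    k • cliffordMul b s = cliffordMul b (k • s) := by
  have hadjoint (b : Vec) (q d : Spinor) :
      spinorInner (k • q) (cliffordMul b (k • d)) = spinorInner q (cliffordMul b d) := by
    rw [spinorInner_cliffordMul, spinorInner_cliffordMul, hk.dsquaring_smul_smul]
  refine eq_of_spinorInner_left fun q => ?_
  obtain ⟨q, rfl⟩ : ∃ p, k • p = q := ⟨k⁻¹ • q, smul_inv_smul k q⟩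
  rw [hadjoint, ← cliffordMul_timeAxis (k • cliffordMul b s), hadjoint, cliffordMul_timeAxis]

theorem Lifts.eq_one_or_neg_one : k = 1 ∨ k = -1 := by
  obtain ⟨r, hr⟩ := exists_eq_smul_of_commute_cliffordMul
    (k := ((k : EndSpinor) : Spinor →ₗ[ℝ] Spinor)) hk.smul_cliffordMul
  have hval : (k : EndSpinor) = r • 1 := ContinuousLinearMap.ext hr
  have hr2 : r = 1 ∨ r = -1 := by
    have h := congrArg Prod.fst (hk ![1, 0, 0, 0])
    rw [one_smul, show k • _ = r • _ from hr _] at h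
    simpa [squaring, norm_smul] using h
  rcases hr2 with rfl | rfl
  · exact Or.inl (Units.ext (by rw [hval, one_smul, Units.val_one]))
  · exact Or.inr (Units.ext (by rw [hval, Units.val_neg, Units.val_one]; module))

end Kernel

/-! ### Generators of `Spin(10,1)` -/

/-- The elements `diag(x, x, -x, -x)` of `𝔰𝔭𝔦𝔫(10,1)`, which generate the boosts. -/
def Spin101Param.boost (x : ℝ) : Spin101Param := ⟨x, 0, 0, 0, 0, 0, 0, zero_mem_spin8⟩

/-- The elements of `𝔰𝔭𝔦𝔫(10)` with coordinates `(r, u, 0, 0)`. On vectors they generate the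
rotations in the planes that contain the `a₂`-axis. -/
def Spin101Param.rotation (r : ℝ) (u : Octonion) : Spin101Param :=
  ⟨0, -r, r, u, 0, 0, 0, zero_mem_spin8⟩

theorem toSpinor_boost (x : ℝ) : (Spin101Param.boost x).toSpinor =
    ofBlocks !![x • 1, 0, 0, 0; 0, x • 1, 0, 0; 0, 0, -(x • 1), 0; 0, 0, 0, -(x • 1)] := by
  have hR : R 0 = 0 := ContinuousLinearMap.ext mul_zero
  have hL : L 0 = 0 := ContinuousLinearMap.ext zero_mul
  simp [Spin101Param.boost, Spin101Param.toSpinor, hR, hL]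

theorem exp_toSpinor_boost (x : ℝ) : NormedSpace.exp (Spin101Param.boost x).toSpinor = ofBlocks
    !![Real.exp x • 1, 0, 0, 0; 0, Real.exp x • 1, 0, 0;
       0, 0, (Real.exp x)⁻¹ • 1, 0; 0, 0, 0, (Real.exp x)⁻¹ • 1] := by
  let N := ofBlocks !![1, 0, 0, 0; 0, 1, 0, 0; 0, 0, -1, 0; 0, 0, 0, -1]
  have hsq : N * N = 1 := by
    refine ContinuousLinearMap.ext fun s => funext fun i => ?_
    fin_cases i <;> simp [N, mul_apply_eq_comp, ofBlocks_apply]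
  have hx : (Spin101Param.boost x).toSpinor = x • N := by
    refine ContinuousLinearMap.ext fun s => funext fun i => ?_
    fin_cases i <;> simp [N, toSpinor_boost, ofBlocks_apply]
  rw [hx, exp_smul_of_sq_eq_one hsq, ← Real.exp_neg, ← Real.cosh_sub_sinh, ← Real.cosh_add_sinh]
  refine ContinuousLinearMap.ext fun s => funext fun i => ?_
  fin_cases i <;>
    simp [N, ofBlocks_apply, add_smul, sub_eq_add_neg, -Real.cosh_add_sinh]

theorem mem_boosts_iff {g : EndSpinorˣ} :
    g ∈ boosts ↔ ∃ x, g = expUnit (Spin101Param.boost x).toSpinor := by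
  simp only [Units.ext_iff, val_expUnit, exp_toSpinor_boost]
  constructor
  · rintro ⟨t, ht, hg⟩
    exact ⟨Real.log t, by rw [hg, Real.exp_log ht]⟩
  · rintro ⟨x, hg⟩
    exact ⟨Real.exp x, Real.exp_pos x, hg⟩

theorem spin10Matrix_eq_toSpinor (r : ℝ) (u v : Octonion) {a : EndO × EndO × EndO}
    (ha : a ∈ spin8) :
    spin10Matrix r u v a = Spin101Param.toSpinor ⟨0, -r, r, u, -v, v, a, ha⟩ := by
  have hR : C * R (-v) = -(C * R v) := ContinuousLinearMap.ext fun x => by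
    simp [mul_apply_eq_comp, R]
  have hL : C * L (-v) = -(C * L v) := ContinuousLinearMap.ext fun x => by
    simp [mul_apply_eq_comp, L]
  simp [Spin101Param.toSpinor, spin10Matrix, hR, hL]

theorem expUnit_toSpinor_rotation_mem_Spin10 (r : ℝ) (u : Octonion) :
    expUnit (Spin101Param.rotation r u).toSpinor ∈ Spin10 := by
  refine Subgroup.subset_closure ⟨r, u, 0, 0, zero_mem_spin8, ?_⟩
  rw [val_expUnit, spin10Matrix_eq_toSpinor r u 0 zero_mem_spin8]
  simp only [neg_zero, Spin101Param.rotation]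

theorem neg_one_mem_Spin10 : (-1 : EndSpinorˣ) ∈ Spin10 := by
  let N := ofBlocks !![0, 0, -1, 0; 0, 0, 0, 1; 1, 0, 0, 0; 0, -1, 0, 0]
  have hsq : N * N = -1 := by
    refine ContinuousLinearMap.ext fun s => funext fun i => ?_
    fin_cases i <;> simp [N, mul_apply_eq_comp, ofBlocks_apply]
  have hpi : (Spin101Param.rotation Real.pi 0).toSpinor = Real.pi • N := by
    refine ContinuousLinearMap.ext fun s => funext fun i => ?_
    fin_cases i <;> simp [N, Spin101Param.toSpinor, Spin101Param.rotation, ofBlocks_apply, L, R,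
      mul_apply_eq_comp]
  have hexp : expUnit (Spin101Param.rotation Real.pi 0).toSpinor = -1 := Units.ext <| by
    rw [val_expUnit, hpi, exp_pi_smul_of_sq_eq_neg_one hsq, Units.val_neg, Units.val_one]
  exact hexp ▸ expUnit_toSpinor_rotation_mem_Spin10 Real.pi 0

theorem Spin10_le_Spin101 : Spin10 ≤ Spin101 := fun _ hg => Subgroup.subset_closure (Or.inl hg)

theorem expUnit_toSpinor_boost_mem_Spin101 (x : ℝ) :
    expUnit (Spin101Param.boost x).toSpinor ∈ Spin101 :=
  Subgroup.subset_closure (Or.inr (mem_boosts_iff.2 ⟨x, rfl⟩))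

theorem Spin101_le_closure_range_expUnit :
    Spin101 ≤ Subgroup.closure (Set.range fun P : Spin101Param => expUnit P.toSpinor) := by
  refine (Subgroup.closure_le _).2 (Set.union_subset ((Subgroup.closure_le _).2 ?_) ?_)
  · rintro g ⟨r, u, v, a, ha, hg⟩
    refine Subgroup.subset_closure ⟨⟨0, -r, r, u, -v, v, a, ha⟩, Units.ext ?_⟩
    rw [hg, spin10Matrix_eq_toSpinor r u v ha, val_expUnit]
  · intro g hg
    obtain ⟨x, rfl⟩ := mem_boosts_iff.1 hg
    exact Subgroup.subset_closure ⟨_, rfl⟩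

theorem Spin101_le_liftGroup : Spin101 ≤ liftGroup := by
  refine Spin101_le_closure_range_expUnit.trans ((Subgroup.closure_le _).2 ?_)
  rintro _ ⟨P, rfl⟩
  exact ⟨_, P.expUnit_toVec_mem_SOUp101, P.lifts_expUnit⟩

theorem InducesOnLieAlgebras.eq {ρ₁ ρ₂ : Spin101 →* SOUp101} (h₁ : InducesOnLieAlgebras ρ₁)
    (h₂ : InducesOnLieAlgebras ρ₂) : ρ₁ = ρ₂ := by
  have hle : Spin101 ≤ (ρ₁.eqLocus ρ₂).map Spin101.subtype := by
    refine Spin101_le_closure_range_expUnit.trans ((Subgroup.closure_le _).2 ?_)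
    rintro _ ⟨P, rfl⟩
    obtain ⟨g₁, hg₁, hρ₁⟩ := h₁.2 P
    obtain ⟨g₂, hg₂, hρ₂⟩ := h₂.2 P
    obtain rfl : g₁ = g₂ := Subtype.ext (Units.ext (hg₁.trans hg₂.symm))
    exact ⟨g₁, Subtype.ext (Units.ext (hρ₁.trans hρ₂.symm)), Units.ext hg₁⟩
  ext1 g
  obtain ⟨g', hg', hgg'⟩ := hle g.2
  rwa [← Subtype.ext hgg']

/-! ### Rotations and reflections -/

section Reflections

variable {E : Type*} [NormedAddCommGroup E] [InnerProductSpace ℝ E]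

/-- The generator of the rotations in the plane of the orthonormal vectors `e` and `f`. -/
def planeRotationGenerator (e f : E) : E →L[ℝ] E :=
  (innerSL ℝ f).smulRight e - (innerSL ℝ e).smulRight f

theorem planeRotationGenerator_apply (e f x : E) :
    planeRotationGenerator e f x = ⟪f, x⟫ • e - ⟪e, x⟫ • f := rfl

theorem smul_planeRotationGenerator (t : ℝ) (e f : E) :
    t • planeRotationGenerator e f = planeRotationGenerator e (t • f) := by
  ext x
  simp only [smul_apply, planeRotationGenerator_apply, real_inner_smul_left]
  module

theorem reflection_orthogonal_span_apply {v : E} (hv : ‖v‖ = 1) (x : E) :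
    (ℝ ∙ v)ᗮ.reflection x = x - (2 * ⟪v, x⟫) • v := by
  rw [Submodule.reflection_orthogonal_apply, Submodule.reflection_singleton_apply, hv]
  simp only [RCLike.ofReal_real_eq_id, id_eq, one_pow, div_one]
  module

theorem exp_planeRotationGenerator [CompleteSpace E] {e f : E} (he : ‖e‖ = 1) (hf : ‖f‖ = 1)
    (hef : ⟪e, f⟫ = 0) (t : ℝ) (x : E) :
    NormedSpace.exp (planeRotationGenerator e ((2 * t) • f)) x =
      (ℝ ∙ (Real.cos t • e - Real.sin t • f))ᗮ.reflection ((ℝ ∙ e)ᗮ.reflection x) := by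
  have hee : ⟪e, e⟫ = 1 := by rw [real_inner_self_eq_norm_sq, he, one_pow]
  have hff : ⟪f, f⟫ = 1 := by rw [real_inner_self_eq_norm_sq, hf, one_pow]
  have hfe : ⟪f, e⟫ = 0 := by rw [real_inner_comm, hef]
  have hsq (y : E) : planeRotationGenerator e f (planeRotationGenerator e f y) =
      -(⟪f, y⟫ • f + ⟪e, y⟫ • e) := by
    simp only [planeRotationGenerator_apply, inner_sub_right, inner_smul_right, hee, hff, hef, hfe]
    module
  have hcube : planeRotationGenerator e f * (planeRotationGenerator e f *
      planeRotationGenerator e f) = -planeRotationGenerator e f := by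
    ext y
    rw [mul_apply_eq_comp, mul_apply_eq_comp, neg_apply, hsq]
    simp only [planeRotationGenerator_apply, inner_sub_right, inner_smul_right, hee, hff,
      hef, hfe]
    module
  have hv : ‖Real.cos t • e - Real.sin t • f‖ = 1 := by
    rw [← sq_eq_sq₀ (norm_nonneg _) zero_le_one, ← real_inner_self_eq_norm_sq]
    simp only [inner_sub_left, inner_sub_right, real_inner_smul_left, real_inner_smul_right, hee,
      hff, hef, hfe]
    linear_combination Real.sin_sq_add_cos_sq t
  rw [← smul_planeRotationGenerator, exp_smul_of_cube_eq_neg hcube,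
    reflection_orthogonal_span_apply he, reflection_orthogonal_span_apply hv]
  simp only [add_apply, smul_apply, one_apply_eq_self,
    mul_apply_eq_comp, hsq]
  simp only [planeRotationGenerator_apply, inner_sub_left, inner_sub_right,
    real_inner_smul_left, real_inner_smul_right, hee, hfe, Real.sin_two_mul, Real.cos_two_mul,
    Real.cos_sq']
  match_scalars
  · ring
  · linear_combination (-2 * ⟪e, x⟫) * Real.sin_sq_add_cos_sq t
  · ring

theorem reflection_orthogonal_span_smul {t : ℝ} (ht : t ≠ 0) (v : E) :
    (ℝ ∙ (t • v))ᗮ.reflection = (ℝ ∙ v)ᗮ.reflection := by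
  simp only [Submodule.span_singleton_smul_eq (IsUnit.mk0 t ht) v]

theorem exists_eq_cos_smul_sub_sin_smul {e v : E} (he : ‖e‖ = 1) (hv : ‖v‖ = 1)
    (hev : v - ⟪e, v⟫ • e ≠ 0) :
    ∃ t f, ‖f‖ = 1 ∧ ⟪e, f⟫ = 0 ∧ v = Real.cos t • e - Real.sin t • f := by
  have hee : ⟪e, e⟫ = 1 := by rw [real_inner_self_eq_norm_sq, he, one_pow]
  set c := ⟪e, v⟫ with hc
  set w := v - c • e with hw
  have hnw : ‖w‖ ^ 2 = 1 - c ^ 2 := by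
    rw [hw, ← real_inner_self_eq_norm_sq]
    simp only [inner_sub_left, inner_sub_right, real_inner_smul_left, real_inner_smul_right, hee,
      real_inner_comm e v, ← hc, real_inner_self_eq_norm_sq v, hv]
    ring
  have hew : ⟪e, w⟫ = 0 := by
    rw [hw, inner_sub_right, inner_smul_right, hee, ← hc, mul_one, sub_self]
  obtain ⟨hc₁, hc₂⟩ := abs_le.1 ((sq_le_one_iff_abs_le_one c).1 (by linarith [sq_nonneg ‖w‖]))
  refine ⟨Real.arccos c, -(‖w‖⁻¹ • w), ?_, ?_, ?_⟩
  · rw [norm_neg]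
    exact norm_smul_inv_norm hev
  · rw [inner_neg_right, inner_smul_right, hew, mul_zero, neg_zero]
  · rw [Real.cos_arccos hc₁ hc₂, Real.sin_arccos, ← hnw, Real.sqrt_sq (norm_nonneg _), smul_neg,
      smul_inv_smul₀ (norm_ne_zero_iff.2 hev), sub_neg_eq_add, hw, add_sub_cancel]

theorem exists_exp_planeRotationGenerator_eq [CompleteSpace E] {e v : E} (he : ‖e‖ = 1)
    (hv : v ≠ 0) : ∃ f, ⟪e, f⟫ = 0 ∧ ∀ x, NormedSpace.exp (planeRotationGenerator e f) x =
      (ℝ ∙ v)ᗮ.reflection ((ℝ ∙ e)ᗮ.reflection x) := by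
  have hv' : ‖v‖⁻¹ ≠ 0 := inv_ne_zero (norm_ne_zero_iff.2 hv)
  rw [← reflection_orthogonal_span_smul hv' v]
  have hn : ‖‖v‖⁻¹ • v‖ = 1 := norm_smul_inv_norm hv
  generalize ‖v‖⁻¹ • v = v at hn
  by_cases hev : v - ⟪e, v⟫ • e = 0
  · have hvc : v = ⟪e, v⟫ • e := sub_eq_zero.1 hev
    have hc : ⟪e, v⟫ ≠ 0 := fun h => by
      rw [hvc, h, zero_smul, norm_zero] at hn
      exact zero_ne_one hn
    refine ⟨0, inner_zero_right _, fun x => ?_⟩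
    rw [hvc, reflection_orthogonal_span_smul hc, Submodule.reflection_reflection,
      ← zero_smul ℝ (0 : E), ← smul_planeRotationGenerator, zero_smul, NormedSpace.exp_zero,
      one_apply_eq_self]
  · obtain ⟨t, f, hf, hef, rfl⟩ := exists_eq_cos_smul_sub_sin_smul he hn hev
    exact ⟨(2 * t) • f, by rw [inner_smul_right, hef, mul_zero],
      exp_planeRotationGenerator he hf hef t⟩

theorem det_reflection_orthogonal_span [FiniteDimensional ℝ E] {v : E} (hv : v ≠ 0) :
    LinearMap.det ((ℝ ∙ v)ᗮ.reflection.toLinearEquiv : E →ₗ[ℝ] E) = -1 := by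
  rw [Submodule.det_reflection, Submodule.orthogonal_orthogonal, finrank_span_singleton hv, pow_one]

theorem det_isometry_mul (φ ψ : E ≃ₗᵢ[ℝ] E) :
    LinearMap.det ((φ * ψ).toLinearEquiv : E →ₗ[ℝ] E) =
      LinearMap.det (φ.toLinearEquiv : E →ₗ[ℝ] E) * LinearMap.det (ψ.toLinearEquiv : E →ₗ[ℝ] E) :=
  LinearMap.det_comp _ _

/-- By Cartan–Dieudonné, an isometry of determinant one is a product of an even number of
reflections. -/
theorem mem_of_forall_reflection_mul_reflection_mem [FiniteDimensional ℝ E]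
    {S : Subgroup (E ≃ₗᵢ[ℝ] E)} {e : E}
    (hS : ∀ v ≠ 0, (ℝ ∙ v)ᗮ.reflection * (ℝ ∙ e)ᗮ.reflection ∈ S) {φ : E ≃ₗᵢ[ℝ] E}
    (hφ : LinearMap.det (φ.toLinearEquiv : E →ₗ[ℝ] E) = 1) : φ ∈ S := by
  obtain ⟨l, -, rfl⟩ := φ.reflections_generate_dim
  suffices h : ∀ l : List E, let φ := (l.map fun v => (ℝ ∙ v)ᗮ.reflection).prod
      (LinearMap.det (φ.toLinearEquiv : E →ₗ[ℝ] E) = 1 ∧ φ ∈ S) ∨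
      (LinearMap.det (φ.toLinearEquiv : E →ₗ[ℝ] E) = -1 ∧ (ℝ ∙ e)ᗮ.reflection * φ ∈ S) by
    obtain ⟨-, hmem⟩ | ⟨hdet, -⟩ := h l
    · exact hmem
    · norm_num [hφ] at hdet
  clear hφ l
  intro l
  induction l with
  | nil => exact Or.inl ⟨LinearMap.det_id, one_mem S⟩
  | cons v l ih =>
    simp only [List.map_cons, List.prod_cons]
    rcases eq_or_ne v 0 with rfl | hv
    · have hone : (ℝ ∙ (0 : E))ᗮ.reflection = 1 := by
        ext x
        exact Submodule.reflection_mem_subspace_eq_self (by simp)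
      simpa only [hone, one_mul] using ih
    simp only [det_isometry_mul, det_reflection_orthogonal_span hv]
    obtain ⟨hdet, hmem⟩ | ⟨hdet, hmem⟩ := ih
    · refine Or.inr ⟨by rw [hdet, mul_one], ?_⟩
      simpa only [mul_inv_rev, Submodule.reflection_inv, mul_assoc] using
        mul_mem (inv_mem (hS v hv)) hmem
    · refine Or.inl ⟨by rw [hdet, neg_mul_neg, one_mul], ?_⟩
      have hS' := mul_mem (hS v hv) hmem
      rwa [mul_assoc, ← mul_assoc _ _ (List.prod _), Submodule.reflection_mul_reflection,
        one_mul] at hS'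

theorem exists_mem_apply_eq_of_forall_reflection_mul_reflection_mem {S : Subgroup (E ≃ₗᵢ[ℝ] E)}
    {e v w : E} (hS : ∀ x ≠ 0, (ℝ ∙ x)ᗮ.reflection * (ℝ ∙ e)ᗮ.reflection ∈ S)
    (hvw : ‖v‖ = ‖w‖) (hew : ⟪e, w⟫ = 0) : ∃ φ ∈ S, φ v = w := by
  by_cases hv : (ℝ ∙ e)ᗮ.reflection v = w
  · refine ⟨1, one_mem S, ?_⟩
    rw [← Submodule.reflection_reflection (ℝ ∙ e)ᗮ v, hv]
    exact Submodule.reflection_mem_subspace_eq_self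
      (Submodule.mem_orthogonal_singleton_iff_inner_right.2 hew)
  · exact ⟨_, hS _ (sub_ne_zero.2 hv),
      Submodule.reflection_sub (by rw [LinearIsometryEquiv.norm_map, hvw])⟩

end Reflections

/-! ### Space and time -/

/-- The Euclidean space `ℝ² ⊕ 𝕆`, which models the orthogonal complement of the time axis. -/
abbrev Space : Type := WithLp 2 (ℝ × WithLp 2 (ℝ × Octonion))

/-- The element of `Space` with the given coordinates. -/
def spaceMk (p q : ℝ) (x : Octonion) : Space := WithLp.toLp 2 (p, WithLp.toLp 2 (q, x))

theorem inner_space (v w : Space) :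
    ⟪v, w⟫ = v.fst * w.fst + v.snd.fst * w.snd.fst + ⟪v.snd.snd, w.snd.snd⟫ := by
  have hmul (s t : ℝ) : ⟪s, t⟫ = s * t := by rw [real_inner_comm, RCLike.inner_apply, conj_trivial]
  rw [WithLp.prod_inner_apply, WithLp.prod_inner_apply, hmul, hmul, ← add_assoc]
  rfl

theorem space_ext {v w : Space} (h₁ : v.fst = w.fst) (h₂ : v.snd.fst = w.snd.fst)
    (h₃ : v.snd.snd = w.snd.snd) : v = w :=
  WithLp.ofLp_injective 2 (Prod.ext h₁ (WithLp.ofLp_injective 2 (Prod.ext h₂ h₃)))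

/-- The decomposition of a vector along the time axis and its orthogonal complement. The space
part is scaled such that the Lorentzian product becomes `-4 τ τ' + ⟪w, w'⟫`. -/
def timeSpace : Vec ≃ₗ[ℝ] ℝ × Space where
  toFun b := ((b.1 + b.2.2.1) / 2, spaceMk (b.1 - b.2.2.1) b.2.1 b.2.2.2)
  invFun c := (c.1 + c.2.fst / 2, c.2.snd.fst, c.1 - c.2.fst / 2, c.2.snd.snd)
  map_add' b c := by
    refine Prod.ext ?_ (space_ext ?_ ?_ ?_) <;> simp [spaceMk] <;> ring
  map_smul' t b := by
    refine Prod.ext ?_ (space_ext ?_ ?_ ?_) <;> simp [spaceMk] <;> ring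
  left_inv b := by
    refine Prod.ext ?_ (Prod.ext ?_ (Prod.ext ?_ ?_)) <;> simp [spaceMk] <;> ring
  right_inv c := by
    refine Prod.ext ?_ (space_ext ?_ ?_ ?_) <;> simp [spaceMk]

theorem lor_eq_timeSpace (a b : Vec) : lor a b =
    -4 * ((timeSpace a).1 * (timeSpace b).1) + ⟪(timeSpace a).2, (timeSpace b).2⟫ := by
  rw [inner_space]
  simp only [lor, timeSpace, spaceMk, LinearEquiv.coe_mk, LinearMap.coe_mk, AddHom.coe_mk,
    WithLp.toLp_fst, WithLp.toLp_snd]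
  ring

theorem timeSpace_timeAxis : timeSpace timeAxis = (1, 0) := by
  refine Prod.ext ?_ (space_ext ?_ ?_ ?_) <;> simp [timeSpace, timeAxis, spaceMk]

theorem lor_timeAxis (b : Vec) : lor b timeAxis = -4 * (timeSpace b).1 := by
  rw [lor_eq_timeSpace, timeSpace_timeAxis, inner_zero_right, mul_one, add_zero]

/-- Isometries of `Space` act on vectors by fixing the time axis. -/
def extendIsometry : (Space ≃ₗᵢ[ℝ] Space) →* EndVecˣ :=
  MonoidHom.toHomUnits
    { toFun := fun φ => LinearMap.toContinuousLinearMap (timeSpace.symm.toLinearMap ∘ₗ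
        LinearMap.id.prodMap φ.toLinearEquiv.toLinearMap ∘ₗ timeSpace.toLinearMap)
      map_one' := ContinuousLinearMap.ext timeSpace.symm_apply_apply
      map_mul' := fun φ ψ => ContinuousLinearMap.ext fun b =>
        congrArg (fun c : ℝ × Space => timeSpace.symm (c.1, φ c.2))
          (timeSpace.apply_symm_apply ((timeSpace b).1, ψ (timeSpace b).2)).symm }

theorem timeSpace_extendIsometry_smul (φ : Space ≃ₗᵢ[ℝ] Space) (b : Vec) :
    timeSpace (extendIsometry φ • b) = ((timeSpace b).1, φ (timeSpace b).2) :=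
  timeSpace.apply_symm_apply _

theorem extendIsometry_smul_timeAxis (φ : Space ≃ₗᵢ[ℝ] Space) :
    extendIsometry φ • timeAxis = timeAxis := timeSpace.injective <| by
  rw [timeSpace_extendIsometry_smul, timeSpace_timeAxis, map_zero]

theorem det_extendIsometry (φ : Space ≃ₗᵢ[ℝ] Space) :
    LinearMap.det ((extendIsometry φ : EndVec) : Vec →ₗ[ℝ] Vec) =
      LinearMap.det (φ.toLinearEquiv : Space →ₗ[ℝ] Space) := by
  have h := LinearMap.det_conj (LinearMap.id.prodMap φ.toLinearEquiv.toLinearMap) timeSpace.symm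
  rw [LinearMap.det_prodMap, LinearMap.det_id, one_mul] at h
  exact h

theorem exists_extendIsometry_eq {h : EndVecˣ} (hh : ∀ a b, lor (h • a) (h • b) = lor a b)
    (hT : h • timeAxis = timeAxis) : ∃ φ, extendIsometry φ = h := by
  have htime (b : Vec) : (timeSpace (h • b)).1 = (timeSpace b).1 := by
    have := hh b timeAxis
    rw [hT, lor_timeAxis, lor_timeAxis] at this
    linarith
  have hsplit (b : Vec) :
      b = (timeSpace b).1 • timeAxis + timeSpace.symm (0, (timeSpace b).2) := by
    refine timeSpace.injective ?_
    rw [map_add, map_smul, timeSpace_timeAxis, timeSpace.apply_symm_apply]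
    ext1 <;> simp
  let A : Space →ₗᵢ[ℝ] Space :=
    { toLinearMap := LinearMap.snd ℝ ℝ Space ∘ₗ timeSpace.toLinearMap ∘ₗ
        ((h : EndVec) : Vec →ₗ[ℝ] Vec) ∘ₗ timeSpace.symm.toLinearMap ∘ₗ LinearMap.inr ℝ ℝ Space
      norm_map' := fun w => by
        have := hh (timeSpace.symm (0, w)) (timeSpace.symm (0, w))
        rw [lor_eq_timeSpace, lor_eq_timeSpace, htime, timeSpace.apply_symm_apply, mul_zero,
          mul_zero, zero_add, zero_add, real_inner_self_eq_norm_sq,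
          real_inner_self_eq_norm_sq] at this
        exact (sq_eq_sq₀ (norm_nonneg _) (norm_nonneg _)).1 this }
  refine ⟨A.toLinearIsometryEquiv rfl, Units.ext <| ContinuousLinearMap.ext fun b =>
    timeSpace.injective <| Prod.ext ?_ ?_⟩
  · exact (congrArg Prod.fst (timeSpace_extendIsometry_smul _ b)).trans (htime b).symm
  · refine (congrArg Prod.snd (timeSpace_extendIsometry_smul _ b)).trans ?_
    change (timeSpace (h • timeSpace.symm (0, (timeSpace b).2))).2 = (timeSpace (h • b)).2
    conv_rhs => rw [hsplit b, smul_add, smul_comm h, hT, map_add, map_smul, timeSpace_timeAxis]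
    simp

/-- The unit vector of `Space` along the coordinate `a₂`. -/
def axis : Space := spaceMk 0 1 0

theorem inner_axis (w : Space) : ⟪axis, w⟫ = w.snd.fst := by
  rw [inner_space]
  simp [axis, spaceMk]

theorem norm_axis : ‖axis‖ = 1 := by
  rw [← sq_eq_sq₀ (norm_nonneg _) zero_le_one, ← real_inner_self_eq_norm_sq, inner_axis, one_pow]
  rfl

theorem timeSpace_toVec_rotation {f : Space} (hf : ⟪axis, f⟫ = 0) (b : Vec) :
    timeSpace ((Spin101Param.rotation (f.fst / 2) ((1 / 2 : ℝ) • C f.snd.snd)).toVec b) =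
      (0, planeRotationGenerator axis f (timeSpace b).2) := by
  rw [inner_axis] at hf
  have hfb : ⟪f, (timeSpace b).2⟫ = f.fst * (b.1 - b.2.2.1) + ⟪f.snd.snd, b.2.2.2⟫ := by
    rw [inner_space, hf, zero_mul, add_zero]
    rfl
  rw [planeRotationGenerator_apply, hfb, inner_axis, Spin101Param.toVec_apply]
  refine Prod.ext ?_ (space_ext ?_ ?_ ?_) <;>
    simp [Spin101Param.rotation, timeSpace, axis, spaceMk, hf, C_C, inner_smul_left]
  · ring
  · ring
  · module

theorem timeSpace_exp_toVec_rotation {f : Space} (hf : ⟪axis, f⟫ = 0) (b : Vec) :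
    timeSpace (NormedSpace.exp
      (Spin101Param.rotation (f.fst / 2) ((1 / 2 : ℝ) • C f.snd.snd)).toVec b) =
      ((timeSpace b).1, NormedSpace.exp (planeRotationGenerator axis f) (timeSpace b).2) := by
  let T : Vec →L[ℝ] ℝ × Space := timeSpace.toContinuousLinearEquiv
  have hT (c : Vec) := timeSpace_toVec_rotation hf c
  refine Prod.ext ?_ ?_
  · have htime := map_exp_apply (N := 0)
      (fun v => ((ContinuousLinearMap.fst ℝ ℝ Space).comp T).hasFDerivAt)
      (fun v => congrArg Prod.fst (hT v)) b
    rwa [NormedSpace.exp_zero] at htime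
  · exact map_exp_apply (fun v => ((ContinuousLinearMap.snd ℝ ℝ Space).comp T).hasFDerivAt)
      (fun v => congrArg Prod.snd (hT v)) b

/-- The transformations of the vectors that are covered by `Spin(10,1)`. -/
def spinImage : Subgroup EndVecˣ where
  carrier := {h | ∃ g ∈ Spin101, Lifts g h}
  mul_mem' := by
    rintro _ _ ⟨g₁, hg₁, hl₁⟩ ⟨g₂, hg₂, hl₂⟩
    exact ⟨_, mul_mem hg₁ hg₂, hl₁.mul hl₂⟩
  one_mem' := ⟨1, one_mem _, lifts_one⟩
  inv_mem' := by
    rintro _ ⟨g, hg, hl⟩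
    exact ⟨_, inv_mem hg, hl.inv⟩

theorem spinImage_le_SOUp101 : spinImage ≤ SOUp101 := by
  rintro h ⟨g, hg, hl⟩
  obtain ⟨h', hh', hl'⟩ := Spin101_le_liftGroup hg
  rwa [hl.unique hl']

theorem extendIsometry_reflection_mul_reflection_mem_spinImage {v : Space} (hv : v ≠ 0) :
    extendIsometry ((ℝ ∙ v)ᗮ.reflection * (ℝ ∙ axis)ᗮ.reflection) ∈ spinImage := by
  obtain ⟨f, hf, hexp⟩ := exists_exp_planeRotationGenerator_eq norm_axis hv
  refine ⟨_, Spin10_le_Spin101 (expUnit_toSpinor_rotation_mem_Spin10 (f.fst / 2)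
    ((1 / 2 : ℝ) • C f.snd.snd)), ?_⟩
  convert Spin101Param.lifts_expUnit _
  refine Units.ext <| ContinuousLinearMap.ext fun b => timeSpace.injective ?_
  rw [val_expUnit, timeSpace_exp_toVec_rotation hf, hexp]
  exact timeSpace_extendIsometry_smul _ b

theorem mem_spinImage_of_smul_timeAxis_eq {h : EndVecˣ} (hh : h ∈ SO101)
    (hT : h • timeAxis = timeAxis) : h ∈ spinImage := by
  obtain ⟨φ, rfl⟩ := exists_extendIsometry_eq hh.2 hT
  refine mem_of_forall_reflection_mul_reflection_mem (S := spinImage.comap extendIsometry)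
    (fun v hv => extendIsometry_reflection_mul_reflection_mem_spinImage hv) ?_
  rw [← det_extendIsometry]
  exact hh.1

/-! ### Transitivity and surjectivity -/

theorem SOUp101_le_SO101 : SOUp101 ≤ SO101 := Subgroup.map_subtype_le _

theorem lor_smul_smul_of_mem_spinImage {h : EndVecˣ} (hh : h ∈ spinImage) (a b : Vec) :
    lor (h • a) (h • b) = lor a b :=
  (SOUp101_le_SO101 (spinImage_le_SOUp101 hh)).2 a b

theorem exists_mem_spinImage_smul_eq (b : Vec) :
    ∃ h ∈ spinImage, ∃ p q : ℝ, h • b = (p, 0, q, 0) ∧ lor b b = -4 * (p * q) ∧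
      lor b timeAxis = -2 * (p + q) := by
  rcases hb : timeSpace b with ⟨τ, w⟩
  have hnorm : ‖spaceMk ‖w‖ 0 0‖ = ‖w‖ := by
    rw [← sq_eq_sq₀ (norm_nonneg _) (norm_nonneg _), ← real_inner_self_eq_norm_sq, inner_space]
    simp [spaceMk, sq]
  obtain ⟨φ, hφ, hφw⟩ := exists_mem_apply_eq_of_forall_reflection_mul_reflection_mem
    (S := spinImage.comap extendIsometry)
    (fun v hv => extendIsometry_reflection_mul_reflection_mem_spinImage hv) hnorm.symm
    (inner_axis (spaceMk ‖w‖ 0 0))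
  have hbφ : extendIsometry φ • b = (τ + ‖w‖ / 2, 0, τ - ‖w‖ / 2, 0) := by
    apply timeSpace.injective
    rw [timeSpace_extendIsometry_smul, hb, hφw]
    refine Prod.ext ?_ (space_ext ?_ ?_ ?_) <;> simp [timeSpace, spaceMk]
  refine ⟨_, hφ, _, _, hbφ, ?_, ?_⟩
  · rw [← lor_smul_smul_of_mem_spinImage hφ, hbφ]
    simp only [lor, inner_zero_left]
    ring
  · rw [← lor_smul_smul_of_mem_spinImage hφ, hbφ, extendIsometry_smul_timeAxis]
    simp only [lor, timeAxis, inner_zero_left]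
    ring

theorem expUnit_toVec_boost_smul_timeAxis (x : ℝ) :
    expUnit (Spin101Param.boost x).toVec • timeAxis =
      (Real.exp (2 * x), 0, Real.exp (-(2 * x)), 0) := by
  have hT : timeAxis = squaring ![1, 0, 0, 0] + squaring ![0, 0, 1, 0] := by
    simp [timeAxis, squaring]
  have hexp (s : Spinor) : expUnit (Spin101Param.boost x).toSpinor • s = ofBlocks _ s :=
    congrArg (fun g : EndSpinor => g s) (exp_toSpinor_boost x)
  rw [hT, smul_add, ← Spin101Param.lifts_expUnit, ← Spin101Param.lifts_expUnit, hexp, hexp]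
  simp [squaring, ofBlocks_apply, norm_smul, ← Real.exp_neg, ← Real.exp_nat_mul]

theorem exists_mem_spinImage_smul_timeAxis_eq {b : Vec} (hb : lor b b = -4)
    (hbT : lor b timeAxis < 0) : ∃ h ∈ spinImage, h • timeAxis = b := by
  obtain ⟨k, hk, p, q, hkb, hself, htime⟩ := exists_mem_spinImage_smul_eq b
  have hpq : p * q = 1 := by linarith
  have hp : 0 < p := by nlinarith [sq_nonneg q]
  refine ⟨_, mul_mem (inv_mem hk) ⟨_, expUnit_toSpinor_boost_mem_Spin101 (Real.log p / 2),
    Spin101Param.lifts_expUnit _⟩, ?_⟩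
  rw [mul_smul, inv_smul_eq_iff, hkb, expUnit_toVec_boost_smul_timeAxis,
    mul_div_cancel₀ _ two_ne_zero, Real.exp_neg, Real.exp_log hp, inv_eq_of_mul_eq_one_right hpq]

theorem mem_spinImage {h : EndVecˣ} (hh : h ∈ SO101) (hT : lor (h • timeAxis) timeAxis < 0) :
    h ∈ spinImage := by
  have hself : lor (h • timeAxis) (h • timeAxis) = -4 := by
    refine (hh.2 timeAxis timeAxis).trans ?_
    rw [lor_timeAxis, timeSpace_timeAxis, mul_one]
  obtain ⟨k, hk, hkT⟩ := exists_mem_spinImage_smul_timeAxis_eq hself hT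
  have hfix : k⁻¹ * h ∈ spinImage := mem_spinImage_of_smul_timeAxis_eq
    (mul_mem (inv_mem (SOUp101_le_SO101 (spinImage_le_SOUp101 hk))) hh)
    (by rw [mul_smul, inv_smul_eq_iff, hkT])
  simpa only [mul_inv_cancel_left] using mul_mem hk hfix

theorem lor_timeAxis_ne_zero {b : Vec} (hb : lor b b < 0) : lor b timeAxis ≠ 0 := by
  rw [lor_timeAxis]
  intro hτ
  rw [lor_eq_timeSpace, (mul_eq_zero.1 hτ).resolve_left (by norm_num), mul_zero, mul_zero,
    zero_add] at hb
  exact hb.not_ge real_inner_self_nonneg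

theorem lor_smul_timeAxis_neg_of_mem_SOUp101 {h : EndVecˣ} (hh : h ∈ SOUp101) :
    lor (h • timeAxis) timeAxis < 0 := by
  obtain ⟨h, hconn, rfl⟩ := hh
  have hself : lor timeAxis timeAxis < 0 := by
    rw [lor_timeAxis, timeSpace_timeAxis]
    norm_num
  let f : SO101 → ℝ := fun k => lor ((k : EndVecˣ) • timeAxis) timeAxis
  have hf : Continuous f := continuous_lor.comp <|
    ((Units.continuous_val.comp continuous_subtype_val).clm_apply continuous_const).prodMk
      continuous_const
  have hf1 : f 1 < 0 := by simpa only [f, OneMemClass.coe_one, one_smul] using hself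
  by_contra! hpos
  obtain ⟨k, -, hk⟩ := isPreconnected_connectedComponent.intermediate_value mem_connectedComponent
    hconn hf.continuousOn ⟨hf1.le, hpos⟩
  exact lor_timeAxis_ne_zero ((k.2.2 timeAxis timeAxis).trans_lt hself) hk

theorem SOUp101_le_spinImage : SOUp101 ≤ spinImage := fun _ hh =>
  mem_spinImage (SOUp101_le_SO101 hh) (lor_smul_timeAxis_neg_of_mem_SOUp101 hh)

/-! ### The covering homomorphism -/

theorem neg_one_mem_Spin101 : (-1 : EndSpinorˣ) ∈ Spin101 := Spin10_le_Spin101 neg_one_mem_Spin10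

theorem Spin101_eq_liftGroup : Spin101 = liftGroup := by
  refine Spin101_le_liftGroup.antisymm ?_
  rintro g ⟨h, hh, hg⟩
  obtain ⟨g', hg', hl⟩ := SOUp101_le_spinImage hh
  have hker : Lifts (g * g'⁻¹) 1 := by simpa only [mul_inv_cancel] using hg.mul hl.inv
  rw [← inv_mul_cancel_right g g']
  refine mul_mem ?_ hg'
  obtain hone | hneg := hker.eq_one_or_neg_one
  · exact hone ▸ one_mem Spin101
  · exact hneg ▸ neg_one_mem_Spin101

theorem expUnit_toSpinor_mem_Spin101 (P : Spin101Param) : expUnit P.toSpinor ∈ Spin101 :=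
  Spin101_eq_liftGroup ▸ ⟨_, P.expUnit_toVec_mem_SOUp101, P.lifts_expUnit⟩

theorem exists_lifts (g : Spin101) : ∃ h : SOUp101, Lifts g h :=
  have ⟨h, hh, hg⟩ := Spin101_le_liftGroup g.2
  ⟨⟨h, hh⟩, hg⟩

/-- The covering homomorphism `ρ`, which maps `g` to the transformation that it lifts. -/
def spinHom : Spin101 →* SOUp101 :=
  MonoidHom.mk' (fun g => (exists_lifts g).choose) fun g₁ g₂ => by
    refine Subtype.ext ((exists_lifts (g₁ * g₂)).choose_spec.unique ?_)
    rw [Subgroup.coe_mul, Subgroup.coe_mul]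
    exact (exists_lifts g₁).choose_spec.mul (exists_lifts g₂).choose_spec

theorem lifts_spinHom (g : Spin101) : Lifts g (spinHom g) := (exists_lifts g).choose_spec

theorem spinHom_eq {g : Spin101} {h : SOUp101} (hg : Lifts g h) : spinHom g = h :=
  Subtype.ext ((lifts_spinHom g).unique hg)

theorem continuous_spinHom : Continuous spinHom :=
  (continuous_of_lifts continuous_subtype_val lifts_spinHom).subtype_mk _

theorem inducesOnLieAlgebras_spinHom : InducesOnLieAlgebras spinHom := by
  refine ⟨continuous_spinHom, fun P => ⟨⟨_, expUnit_toSpinor_mem_Spin101 P⟩, rfl, ?_⟩⟩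
  have hP : spinHom ⟨_, expUnit_toSpinor_mem_Spin101 P⟩ = ⟨_, P.expUnit_toVec_mem_SOUp101⟩ :=
    spinHom_eq P.lifts_expUnit
  rw [hP, val_expUnit]

theorem spinHom_surjective : Function.Surjective spinHom := fun h =>
  have ⟨g, hg, hl⟩ := SOUp101_le_spinImage h.2
  ⟨⟨g, hg⟩, spinHom_eq hl⟩

theorem coe_ker_spinHom :
    (spinHom.ker : Set Spin101) = {1, ⟨-1, neg_one_mem_Spin101⟩} := by
  ext g
  simp only [SetLike.mem_coe, MonoidHom.mem_ker, Set.mem_insert_iff, Set.mem_singleton_iff,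
    Subtype.ext_iff (a1 := g), OneMemClass.coe_one]
  constructor
  · intro hg
    have hl := lifts_spinHom g
    rw [hg] at hl
    exact hl.eq_one_or_neg_one
  · rintro (hg | hg)
    · exact spinHom_eq (hg ▸ lifts_one)
    · refine spinHom_eq fun s => ?_
      rw [hg, OneMemClass.coe_one, one_smul, show (-1 : EndSpinorˣ) • s = -s from rfl]
      simp [squaring]

theorem ncard_preimage_spinHom (h : SOUp101) : (spinHom ⁻¹' {h}).ncard = 2 := by
  have hne : (1 : EndSpinorˣ) ≠ -1 := fun h => by
    have hone : (1 : Octonion) = -1 := congrArg (fun k : EndSpinorˣ => (k • (1 : Spinor)) 0) h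
    have : IsAddTorsionFree Octonion := .of_isTorsionFree ℝ Octonion
    exact one_ne_zero (norm_one.symm.trans (norm_eq_zero.2 (self_eq_neg.1 hone)))
  rw [← Nat.card_coe_set_eq,
    Nat.card_congr (spinHom.fiberEquivKerOfSurjective spinHom_surjective h),
    ← SetLike.coe_sort_coe, Nat.card_coe_set_eq, coe_ker_spinHom]
  exact Set.ncard_pair fun h => hne (congrArg Subtype.val h)

/-! ### The covering property -/

section Topology

theorem isCoveringMap_of_finite_ker {G H : Type*} [Group G] [TopologicalSpace G]
    [IsTopologicalGroup G] [SigmaCompactSpace G] [T1Space G] [Group H] [TopologicalSpace H]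
    [ContinuousMul H] [T2Space H] [BaireSpace H] {f : G →* H} (hf : Continuous f)
    (hsurj : Function.Surjective f) (hker : (f.ker : Set G).Finite) : IsCoveringMap f :=
  have hopen : IsOpenMap f := f.isOpenMap_of_sigmaCompact hsurj hf
  have hquot := hopen.isQuotientMap hf hsurj
  (hquot.isQuotientCoveringMap_of_isDiscrete_ker_monoidHom hker.isDiscrete).isCoveringMap

variable {E : Type*} [NormedAddCommGroup E] [NormedSpace ℝ E] [FiniteDimensional ℝ E]

instance : LocallyCompactSpace (E →L[ℝ] E)ˣ :=
  have : ProperSpace (E →L[ℝ] E) := FiniteDimensional.proper ℝ _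
  have : CompleteSpace E := FiniteDimensional.complete ℝ E
  Units.isOpenEmbedding_val.locallyCompactSpace

instance : SecondCountableTopology (E →L[ℝ] E)ˣ :=
  have : ProperSpace (E →L[ℝ] E) := FiniteDimensional.proper ℝ _
  have : CompleteSpace E := FiniteDimensional.complete ℝ E
  Units.isOpenEmbedding_val.isInducing.secondCountableTopology

end Topology

theorem isClosed_SO101 : IsClosed (SO101 : Set EndVecˣ) := by
  have hval : Continuous fun h : EndVecˣ => (h : EndVec) := Units.continuous_val
  have hdet : IsClosed {h : EndVecˣ | ContinuousLinearMap.det (h : EndVec) = 1} :=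
    isClosed_eq (ContinuousLinearMap.continuous_det.comp hval) continuous_const
  have hlor : IsClosed {h : EndVecˣ | ∀ a b, lor (h • a) (h • b) = lor a b} := by
    simp only [Set.ofPred_forall]
    exact isClosed_iInter fun a => isClosed_iInter fun b => isClosed_eq (continuous_lor.comp
      ((hval.clm_apply continuous_const).prodMk (hval.clm_apply continuous_const)))
      continuous_const
  exact hdet.inter hlor

theorem isClosed_SOUp101 : IsClosed (SOUp101 : Set EndVecˣ) := by
  rw [SOUp101, Subgroup.coe_map]
  exact isClosed_SO101.isClosedMap_subtype_val _ isClosed_connectedComponent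

instance : LocallyCompactSpace SOUp101 :=
  isClosed_SOUp101.isClosedEmbedding_subtypeVal.locallyCompactSpace

theorem isClosed_lifts : IsClosed {p : EndSpinorˣ × EndVecˣ | Lifts p.1 p.2} := by
  have hg : Continuous fun p : EndSpinorˣ × EndVecˣ => (p.1 : EndSpinor) :=
    Units.continuous_val.comp continuous_fst
  have hh : Continuous fun p : EndSpinorˣ × EndVecˣ => (p.2 : EndVec) :=
    Units.continuous_val.comp continuous_snd
  simp only [Lifts, Set.ofPred_forall]
  exact isClosed_iInter fun s => isClosed_eq
    (continuous_squaring.comp (hg.clm_apply continuous_const)) (hh.clm_apply continuous_const)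

instance : SigmaCompactSpace Spin101 := by
  have hclosed : IsClosed {p : EndSpinorˣ × EndVecˣ | p.2 ∈ SOUp101 ∧ Lifts p.1 p.2} :=
    (isClosed_SOUp101.preimage continuous_snd).inter isClosed_lifts
  have himage : (Spin101 : Set EndSpinorˣ) =
      Prod.fst '' {p : EndSpinorˣ × EndVecˣ | p.2 ∈ SOUp101 ∧ Lifts p.1 p.2} := by
    rw [Spin101_eq_liftGroup]
    ext g
    exact ⟨fun ⟨h, hh, hg⟩ => ⟨(g, h), ⟨hh, hg⟩, rfl⟩,
      by rintro ⟨⟨g, h⟩, ⟨hh, hg⟩, rfl⟩; exact ⟨h, hh, hg⟩⟩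
  have hsigma : IsSigmaCompact (Spin101 : Set EndSpinorˣ) := himage ▸
    (isSigmaCompact_univ.of_isClosed_subset hclosed (Set.subset_univ _)).image continuous_fst
  exact isSigmaCompact_iff_sigmaCompactSpace.1 hsigma

theorem isCoveringMap_spinHom : IsCoveringMap spinHom :=
  isCoveringMap_of_finite_ker continuous_spinHom spinHom_surjective
    (coe_ker_spinHom ▸ Set.toFinite _)

/-! ### The squaring map -/

theorem quartic_eq (s : Spinor) : quartic s = -(1 / 4) * lor (squaring s) (squaring s) := by
  have hinner := inner_mul_mul_add (s 0) (s 2) (s 1) (s 3)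
  have hnorm : ⟪s 0 * s 3 + s 2 * s 1, s 0 * s 3 + s 2 * s 1⟫ =
      ‖s 0‖ ^ 2 * ‖s 3‖ ^ 2 + ‖s 2‖ ^ 2 * ‖s 1‖ ^ 2 + 2 * ⟪s 0 * s 3, s 2 * s 1⟫ := by
    rw [real_inner_self_eq_norm_sq, norm_add_sq_real, norm_mul_sq, norm_mul_sq]
    ring
  simp only [quartic, lor, squaring, real_inner_smul_left, real_inner_smul_right, hnorm]
  linear_combination 2 * hinner

theorem lor_squaring_nonpos (s : Spinor) : lor (squaring s) (squaring s) ≤ 0 := by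
  obtain ⟨h, ⟨g, -, hg⟩, p, q, hs, hself, -⟩ := exists_mem_spinImage_smul_eq (squaring s)
  have hgs : squaring (g • s) = (p, 0, q, 0) := (hg s).trans hs
  simp only [squaring, Prod.mk.injEq] at hgs
  have hp : 0 ≤ p := hgs.1 ▸ add_nonneg (sq_nonneg _) (sq_nonneg _)
  have hq : 0 ≤ q := hgs.2.2.1 ▸ add_nonneg (sq_nonneg _) (sq_nonneg _)
  linarith [mul_nonneg hp hq]

theorem exists_squaring_eq_of_nonneg {p q : ℝ} (hp : 0 ≤ p) (hq : 0 ≤ q) :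
    ∃ s, squaring s = (p, 0, q, 0) := by
  let i : Octonion := Octonion.mk 0 1
  have hi : ‖i‖ = 1 := by
    rw [← sq_eq_sq₀ (norm_nonneg _) zero_le_one, ← real_inner_self_eq_norm_sq,
      inner_eq_inner_fst_add_inner_snd]
    simp [i, fst_mk, snd_mk]
  have hi1 : ⟪(1 : Octonion), i⟫ = 0 := by
    simp [inner_eq_inner_fst_add_inner_snd, fst_one, snd_one, i, fst_mk, snd_mk]
  refine ⟨![√p • 1, 0, √q • i, 0], ?_⟩
  simp [squaring, norm_smul, Real.sq_sqrt, hp, hq, hi, hi1, real_inner_smul_left,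
    real_inner_smul_right]

theorem exists_squaring_eq {b : Vec} (hb : lor b b ≤ 0) (hbT : lor b timeAxis < 0) :
    ∃ s, squaring s = b := by
  obtain ⟨h, ⟨g, -, hg⟩, p, q, hhb, hself, htime⟩ := exists_mem_spinImage_smul_eq b
  have hp : 0 ≤ p := by nlinarith [sq_nonneg q]
  have hq : 0 ≤ q := by nlinarith [sq_nonneg p]
  obtain ⟨s, hs⟩ := exists_squaring_eq_of_nonneg hp hq
  exact ⟨g⁻¹ • s, by rw [hg.inv, hs, inv_smul_eq_iff, hhb]⟩

theorem lor_squaring_timeAxis (s : Spinor) :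
    lor (squaring s) timeAxis = -2 * ∑ i, ‖s i‖ ^ 2 := by
  simp only [lor, timeAxis, squaring, inner_zero_right, Fin.sum_univ_four]
  ring

theorem eq_zero_of_lor_squaring_timeAxis_nonneg {s : Spinor}
    (hs : 0 ≤ lor (squaring s) timeAxis) : s = 0 := by
  have hnonneg (i : Fin 4) : 0 ≤ ‖s i‖ ^ 2 := sq_nonneg _
  have hsum : ∑ i, ‖s i‖ ^ 2 = 0 := by
    rw [lor_squaring_timeAxis] at hs
    exact le_antisymm (by linarith) (Finset.sum_nonneg fun i _ => hnonneg i)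
  funext i
  have hi := (Finset.sum_eq_zero_iff_of_nonneg fun i _ => hnonneg i).1 hsum i (Finset.mem_univ i)
  exact norm_eq_zero.1 (sq_eq_zero_iff.1 hi)

theorem squaring_zero : squaring 0 = 0 := by simp [squaring]

theorem range_squaring : Set.range squaring = {0} ∪ forwardLightCone ∪ futureTimelike := by
  refine Set.Subset.antisymm ?_ ?_
  · rintro _ ⟨s, rfl⟩
    obtain hT | hT := lt_or_ge (lor (squaring s) timeAxis) 0
    · obtain hnull | hneg := (lor_squaring_nonpos s).eq_or_lt
      · exact Or.inl (Or.inr ⟨hnull, hT⟩)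
      · exact Or.inr ⟨hneg, hT⟩
    · rw [eq_zero_of_lor_squaring_timeAxis_nonneg hT, squaring_zero]
      exact Or.inl (Or.inl rfl)
  · rintro b ((rfl | ⟨hnull, hT⟩) | ⟨hneg, hT⟩)
    · exact ⟨0, squaring_zero⟩
    · exact exists_squaring_eq hnull.le hT
    · exact exists_squaring_eq hneg.le hT

theorem squaring_smul (g : Spin101) (s : Spinor) : squaring (g • s) = spinHom g • squaring s :=
  lifts_spinHom g s

theorem quartic_smul (g : Spin101) (s : Spinor) : quartic (g • s) = quartic s := by
  have hlor := (SOUp101_le_SO101 (spinHom g).2).2 (squaring s) (squaring s)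
  rw [quartic_eq, quartic_eq, squaring_smul]
  exact congrArg (-(1 / 4) * ·) hlor

theorem squaring_image_orbit (s : Spinor) :
    squaring '' MulAction.orbit Spin101 s = MulAction.orbit SOUp101 (squaring s) := by
  refine Set.Subset.antisymm ?_ ?_
  · rintro _ ⟨_, ⟨g, rfl⟩, rfl⟩
    exact ⟨spinHom g, (squaring_smul g s).symm⟩
  · rintro _ ⟨h, rfl⟩
    obtain ⟨g, rfl⟩ := spinHom_surjective h
    exact ⟨g • s, ⟨g, rfl⟩, squaring_smul g s⟩

end Bryant

end

theorem mainTheorem6 :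
    ∃ ρ : Bryant.Spin101 →* Bryant.SOUp101,
      (Bryant.InducesOnLieAlgebras ρ ∧
        ∀ ρ₂ : Bryant.Spin101 →* Bryant.SOUp101, Bryant.InducesOnLieAlgebras ρ₂ → ρ₂ = ρ) ∧
      (IsCoveringMap ρ ∧ ∀ w : Bryant.SOUp101, (ρ ⁻¹' {w}).ncard = 2) ∧
      (∀ (g : Bryant.Spin101) (z : Bryant.Spinor),
        Bryant.squaring (g • z) = ρ g • Bryant.squaring z) ∧
      (∀ z : Bryant.Spinor,
        Bryant.quartic z = -(1 / 4) * Bryant.lor (Bryant.squaring z) (Bryant.squaring z)) ∧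
      (∀ (g : Bryant.Spin101) (z : Bryant.Spinor), Bryant.quartic (g • z) = Bryant.quartic z) ∧
      (∀ z : Bryant.Spinor,
        Bryant.squaring '' MulAction.orbit Bryant.Spin101 z =
          MulAction.orbit Bryant.SOUp101 (Bryant.squaring z)) ∧
      Set.range Bryant.squaring =
        {0} ∪ Bryant.forwardLightCone ∪ Bryant.futureTimelike :=
  ⟨Bryant.spinHom,
    ⟨Bryant.inducesOnLieAlgebras_spinHom, fun _ h => h.eq Bryant.inducesOnLieAlgebras_spinHom⟩,
    ⟨Bryant.isCoveringMap_spinHom, Bryant.ncard_preimage_spinHom⟩, Bryant.squaring_smul,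
    Bryant.quartic_eq, Bryant.quartic_smul, Bryant.squaring_image_orbit, Bryant.range_squaring⟩
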